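/- For each sample size $T$ let $G=G_T$ be a number of groups with sizes $g_1,\dots,g_G\ge 1$, $\widetilde g=\sum_j g_j$, and let $\mathbf Z=(\mathbf Z_1,\dots,\mathbf Z_G)$ be a given $T\times\widetilde g$ matrix (the analysis is conditional on $\mathbf Z$) whose block $\mathbf Z_j$ has $g_j$ columns; $\theta=(\theta_1,\dots,\theta_G)\in\mathbb R^{\widetilde g}$ is partitioned accordingly, and $\|\mathbf Z\|_o:=\max_j\|\mathbf Z_j\|_{op}$ (spectral norms). The model is $y\mid\theta,\sigma^2\sim\mathcal N_T(\mathbf Z\theta,\sigma^2\mathbf I_T)$ with the following prior (BMIDAS-AGL-SS): $\sigma^2\sim\text{Inv-Gamma}(a_1,b_1)$ and $\pi_0\sim\text{Beta}(c,d)$ are independent and, given $(\sigma^2,\pi_0)$, the groups are independent with $\theta_j\sim(1-\pi_0)\,\text{M-Laplace}(0,\sigma/\lambda_j)+\pi_0\delta_0$, where $\text{M-Laplace}(0,\sigma/\lambda_j)$ has density $\frac{\Gamma(g_j/2)}{2\pi^{g_j/2}\Gamma(g_j)}(\lambda_j/\sigma)^{g_j}e^{-\lambda_j\|\theta_j\|_2/\sigma}$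 on $\mathbb R^{g_j}$ and $\lambda_j>0$. Write $\Pi(\cdot\mid y,\mathbf Z)$ for the posterior and $\mathbf E_0$ for the expectation over $y\sim\mathcal N_T(\mathbf Z\theta_0,\sigma_0^2\mathbf I_T)$. The quantities $G,g_j,\mathbf Z,\lambda_j,c,d$ and an integer $s_0\le G$ may depend on $T$. Fix constants $0<\underline\sigma^2\le\overline\sigma^2<\infty$, $c_g,c_\theta,c_{\pi_0},u,\underline d>0$, $1<\underline c<\overline C<\infty$ and $a_1>1$. There is $M_0>0$, depending only on these constants, such that the following holds for every $b_1>0$. Suppose that for all sufficiently large $T$: 1. $\max_j g_j\le c_g\log(G)/\log(T)$; 2. $\|\mathbf Z\|_o/\sqrt T<\sqrt{\log T}$ and, for every $j$, $\underline c\,\|\mathbf Z\|_o/\sqrt T\le\lambda_j\le\overline C\min\{\sqrt{\log T},\sqrt{\log G}\,\|\mathbf Z\|_o\}$; 3. $c>0$, $\underline d\le d\le s_0$, $\log(G+c)\le c_{\pi_0}\log G$, and $\frac{d+j-1}{c+G-j}\le\frac{j}{G^u(G-j+1)}$ for all $j\in\{1,\dots,G\}$; and that $\epsilon:=\max\{\sqrt{s_0\log(G)/T},\sqrt{\log(T)/T}\}\to0$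 as $T\to\infty$. Then for every $M\ge M_0$, $$\sup_{\theta_0,\ \sigma_0^2}\ \mathbf E_0\Big[\Pi\big(\theta:\ \|\mathbf Z(\theta-\theta_0)\|_2^2\ge M\,T\epsilon^2\ \big|\ y,\mathbf Z\big)\Big]\longrightarrow0\qquad(T\to\infty),$$ where the supremum is over all $\sigma_0^2\in[\underline\sigma^2,\overline\sigma^2]$ and all $\theta_0\in\mathbb R^{\widetilde g}$ with at most $s_0$ nonzero groups and $\|\theta_0\|_\infty\le c_\theta\sqrt{\log G}$. -/

import Mathlib

open MeasureTheory ProbabilityTheory Filter Topology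
open scoped ENNReal

namespace BMIDAS

noncomputable section

/-- The data of the grouped linear model at sample size `T`, together with the hyper-parameters of
the prior that may vary with the sample size: the number of groups `G`, the group sizes `g j`, the
`T × (∑ j, g j)` regressor matrix `Z`, whose columns are indexed by pairs (group, position in the
group), the penalty parameters `lam j`, and the parameters `c`, `d` of the Beta prior of the spike
probability. -/
structure Model (T : ℕ) where
  G : ℕ
  g : Fin G → ℕ
  Z : Matrix (Fin T) (Σ j : Fin G, Fin (g j)) ℝ
  lam : Fin G → ℝ
  c : ℝ
  d : ℝ

/-- The slope vectors `θ = (θ_1, …, θ_G)`, with `θ_j ∈ ℝ^{g_j}` carrying the Euclidean norm. -/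
abbrev Model.Theta {T : ℕ} (m : Model T) : Type :=
  (j : Fin m.G) → EuclideanSpace ℝ (Fin (m.g j))

/-- The regression function `Z θ`. -/
def Model.mean {T : ℕ} (m : Model T) (θ : m.Theta) : Fin T → ℝ :=
  m.Z.mulVec (fun p => θ p.1 p.2)

/-- The squared in-sample prediction error `‖Z (θ - θ')‖₂²`. -/
def Model.predError {T : ℕ} (m : Model T) (θ θ' : m.Theta) : ℝ :=
  ∑ t, (m.mean (θ - θ') t) ^ 2

/-- The number of nonzero groups of `θ`. -/
def Model.sparsity {T : ℕ} (m : Model T) (θ : m.Theta) : ℕ :=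
  {j : Fin m.G | θ j ≠ 0}.ncard

section
open scoped Matrix.Norms.L2Operator

/-- `‖Z‖_o`: the largest spectral norm of the column blocks `Z_j` of `Z`. -/
def Model.blockNorm {T : ℕ} (m : Model T) : ℝ :=
  ⨆ j : Fin m.G, ‖m.Z.submatrix id (fun k : Fin (m.g j) => (⟨j, k⟩ : Σ j : Fin m.G, Fin (m.g j)))‖

end

/-- The normal law `N_T(Z θ, s I_T)` of the observations, for slopes `θ` and variance `s`. -/
def Model.dataLaw {T : ℕ} (m : Model T) (θ : m.Theta) (s : ℝ) : Measure (Fin T → ℝ) :=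
  Measure.pi fun t => gaussianReal (m.mean θ t) s.toNNReal

/-- The density at `y` of `N_T(Z θ, s I_T)`. -/
def Model.likelihood {T : ℕ} (m : Model T) (y : Fin T → ℝ) (θ : m.Theta) (s : ℝ) : ℝ≥0∞ :=
  ∏ t, gaussianPDF (m.mean θ t) s.toNNReal (y t)

/-- The inverse Gamma law with shape `a` and scale `b`. -/
def invGamma (a b : ℝ) : Measure ℝ :=
  volume.withDensity fun x =>
    ENNReal.ofReal (if 0 < x then b ^ a / Real.Gamma a * x ^ (-a - 1) * Real.exp (-b / x) else 0)

/-- The `n`-dimensional Multi-Laplace law, with density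
`Γ(n/2) / (2 π^{n/2} Γ(n)) * ρ^n * exp (-ρ ‖x‖₂)` where `ρ = lam / √s`. -/
def multiLaplace (n : ℕ) (lam s : ℝ) : Measure (EuclideanSpace ℝ (Fin n)) :=
  volume.withDensity fun x =>
    ENNReal.ofReal (Real.Gamma ((n : ℝ) / 2) / (2 * Real.pi ^ ((n : ℝ) / 2) * Real.Gamma n)
      * (lam / √s) ^ n * Real.exp (-(lam / √s) * ‖x‖))

/-- The prior of one group given the variance `s` and the spike probability `p`. -/
def spikeSlab (n : ℕ) (lam s p : ℝ) : Measure (EuclideanSpace ℝ (Fin n)) :=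
  ENNReal.ofReal (1 - p) • multiLaplace n lam s + ENNReal.ofReal p • Measure.dirac 0

/-- The joint prior of `(θ, σ²)`: `σ² ~ Inv-Gamma(a, b)` and `π₀ ~ Beta(c, d)` are independent and,
given both, the groups `θ_j` are independent with the spike-and-slab law; `π₀` is integrated
out. -/
def Model.prior {T : ℕ} (m : Model T) (a b : ℝ) : Measure (m.Theta × ℝ) :=
  ((invGamma a b).prod (betaMeasure m.c m.d)).bind fun q =>
    (Measure.pi fun j => spikeSlab (m.g j) (m.lam j) q.1 q.2).map fun θ => (θ, q.1)

/-- The posterior law of `(θ, σ²)` given the observations `y`, by Bayes' formula. -/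
def Model.posterior {T : ℕ} (m : Model T) (a b : ℝ) (y : Fin T → ℝ) : Measure (m.Theta × ℝ) :=
  (∫⁻ q, m.likelihood y q.1 q.2 ∂(m.prior a b))⁻¹ •
    (m.prior a b).withDensity fun q => m.likelihood y q.1 q.2

/-- The rate `ε = max {√(s₀ log G / T), √(log T / T)}`. -/
def Model.rate {T : ℕ} (m : Model T) (s₀ : ℕ) : ℝ :=
  max √(s₀ * Real.log m.G / T) √(Real.log T / T)

/-- The true slope vectors: at most `s₀` nonzero groups and all coordinates bounded in absolute
value by `cθ √(log G)`. -/
def Model.trueSlopes {T : ℕ} (m : Model T) (cθ : ℝ) (s₀ : ℕ) : Set m.Theta :=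
  {θ | m.sparsity θ ≤ s₀ ∧ ∀ j k, |θ j k| ≤ cθ * √(Real.log m.G)}

/-- Groups are nonempty, and their size grows slowly: `g_max ≤ cg log G / log T`. -/
def Model.GroupSize {T : ℕ} (m : Model T) (cg : ℝ) : Prop :=
  ∀ j, 1 ≤ m.g j ∧ (m.g j : ℝ) ≤ cg * Real.log m.G / Real.log T

/-- The bound on the regressors and the range of the (positive) penalty parameters. -/
def Model.Penalty {T : ℕ} (m : Model T) (clo Chi : ℝ) : Prop :=
  m.blockNorm / √T < √(Real.log T) ∧
  ∀ j, 0 < m.lam j ∧ m.blockNorm * clo / √T ≤ m.lam j ∧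
    m.lam j ≤ Chi * min √(Real.log T) (√(Real.log m.G) * m.blockNorm)

/-- The conditions on the parameters `c > 0` and `d > 0` of the Beta prior. -/
def Model.BetaHyper {T : ℕ} (m : Model T) (s₀ : ℕ) (u cπ dlo : ℝ) : Prop :=
  0 < m.c ∧ dlo ≤ m.d ∧ m.d ≤ s₀ ∧
  (∀ j ∈ Finset.Icc 1 m.G,
    (m.d + j - 1) / (m.c + m.G - j) ≤ j / ((m.G : ℝ) ^ u * (m.G - j + 1))) ∧
  Real.log (m.G + m.c) ≤ cπ * Real.log m.G

end

end BMIDAS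

namespace BMIDAS

/-! No tests and no localisation of `σ²` are used. Everything is compared with one random quantity,
the peak: the likelihood with the residual sum of squares `rss` of `θ₀`, maximised over the
variance, the maximiser being `V = rss / T`. Write `R = T ε²`, which is of the order of `s₀ log G`.

The data are restricted to `typicalSet`: `V` lies between constants, and the noise has a small
projection onto the column span of any `(K + 1) s₀` groups. Chi-square tails and a union bound over
the spans make the complement negligible (`dataLaw_compl_typicalSet_le`). On this event three
estimates meet.

Evidence. Slopes in a tiny product of balls around the nonzero groups of `θ₀`, with exact zeros
elsewhere, and variances in a window of width `V / T` above `V` have likelihood within a constant of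
the peak. Their prior mass is the product of a multi-Laplace ball mass, a beta moment and an inverse
Gamma mass, so the evidence is at least the peak times `exp (-(C₁ + C₂ + 2) R)`
(`exp_neg_le_evidence`).

Sparse slopes with prediction error at least `Q = M R`. The difference from `θ₀` is supported on `(K
+ 1) s₀` groups, so the noise barely correlates with it and the residual sum of squares grows by `Q
/ 2`. Whatever the variance, the likelihood is then at most the peak times `exp (-Q / (16 vhi))`
(`likelihood_le_of_mem_typicalSet`).

Slopes with at least `K s₀` nonzero groups. The beta condition makes their prior mass at most `exp
(-(C₁ + C₂ + 3) R)` for `K` large (`prior_sparsity_le_exp`), and Tonelli bounds their expected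
posterior mass by prior mass over evidence cost (`lintegral_posterior_le`).

Both exponents beat the evidence cost by `R ≥ log T`, so each contribution is at most `1 / T`,
uniformly in `θ₀` and `σ₀²`. -/

/-! ### Product measures and Gaussian tail bounds. -/

theorem lintegral_fin_prod_eq_prod {n : ℕ} {E : Type*} [MeasurableSpace E]
    (μ : Fin n → Measure E) [∀ i, SigmaFinite (μ i)]
    (f : Fin n → E → ℝ≥0∞) (hf : ∀ i, Measurable (f i)) :
    ∫⁻ x, ∏ i, f i (x i) ∂(Measure.pi μ) = ∏ i, ∫⁻ x, f i x ∂(μ i) := by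
  induction n with
  | zero => simp
  | succ n ih =>
    have h := ((measurePreserving_piFinSuccAbove μ 0).symm).lintegral_comp_emb
      (MeasurableEquiv.measurableEmbedding _) (fun x ↦ ∏ i, f i (x i))
    rw [← h, Fin.prod_univ_succ, ← ih _ _ fun i ↦ hf i.succ]
    have h0 : ∀ (a : E × (Fin n → E)), ∏ i, f i
        ((MeasurableEquiv.piFinSuccAbove (fun _ : Fin (n + 1) ↦ E) 0).symm a i) =
        f 0 a.1 * ∏ i : Fin n, f i.succ (a.2 i) := fun a ↦ by
      rw [Fin.prod_univ_succ]
      rfl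
    refine (lintegral_congr h0).trans ?_
    refine lintegral_prod_mul (g := fun y : Fin n → E ↦ ∏ i : Fin n, f i.succ (y i))
      (hf 0).aemeasurable (Measurable.aemeasurable ?_)
    exact Finset.measurable_prod _ fun i _ ↦ (hf i.succ).comp (measurable_pi_apply i)

theorem pi_withDensity {n : ℕ} {E : Type*} [MeasurableSpace E]
    (μ : Fin n → Measure E) [∀ i, SigmaFinite (μ i)]
    (f : Fin n → E → ℝ≥0∞) (hf : ∀ i, Measurable (f i))
    [∀ i, SigmaFinite ((μ i).withDensity (f i))] :
    Measure.pi (fun i ↦ (μ i).withDensity (f i)) =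
      (Measure.pi μ).withDensity fun x ↦ ∏ i, f i (x i) := by
  refine Measure.pi_eq fun s hs ↦ ?_
  rw [withDensity_apply _ (MeasurableSet.univ_pi hs),
    ← lintegral_indicator (MeasurableSet.univ_pi hs)]
  have : (Set.univ.pi s).indicator (fun x ↦ ∏ i, f i (x i)) =
      fun x ↦ ∏ i, (s i).indicator (f i) (x i) := by
    ext x
    by_cases hx : x ∈ Set.univ.pi s
    · rw [Set.indicator_of_mem hx]
      exact Finset.prod_congr rfl fun i _ ↦ (Set.indicator_of_mem (hx i trivial) _).symm
    · rw [Set.indicator_of_notMem hx]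
      simp only [Set.mem_pi, Set.mem_univ, forall_const, not_forall] at hx
      obtain ⟨i, hi⟩ := hx
      exact (Finset.prod_eq_zero (Finset.mem_univ i) (Set.indicator_of_notMem hi _)).symm
  rw [this, lintegral_fin_prod_eq_prod _ _ fun i ↦ (hf i).indicator (hs i)]
  exact Finset.prod_congr rfl fun i _ ↦ by
    rw [withDensity_apply _ (hs i), lintegral_indicator (hs i)]

/-- The tilt changes the precision from `1` to `1 + t`, leaving a ratio of normalising constants.
Negative `t` serves upper tails and positive `t` lower tails. -/
theorem lintegral_exp_sq_gaussianReal (t : ℝ) (ht : -1 < t) :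
    ∫⁻ x, ENNReal.ofReal (Real.exp (-(t / 2) * x ^ 2)) ∂(gaussianReal 0 1) =
      ENNReal.ofReal (√(1 / (1 + t))) := by
  have ht' : 0 < 1 + t := by linarith
  rw [gaussianReal_of_var_ne_zero _ one_ne_zero,
    lintegral_withDensity_eq_lintegral_mul _ (measurable_gaussianPDF _ _) (by fun_prop)]
  have : ∀ x, (gaussianPDF 0 1 * fun x ↦ ENNReal.ofReal (Real.exp (-(t / 2) * x ^ 2))) x =
      ENNReal.ofReal ((√(2 * Real.pi))⁻¹ * Real.exp (-((1 + t) / 2) * x ^ 2)) := by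
    intro x
    rw [Pi.mul_apply, gaussianPDF, ← ENNReal.ofReal_mul (gaussianPDFReal_nonneg _ _ _),
      gaussianPDFReal, mul_assoc, ← Real.exp_add]
    congr 3
    · simp
    · simp; ring
  simp_rw [this]
  rw [← ofReal_integral_eq_lintegral_ofReal
    ((integrable_exp_neg_mul_sq (by positivity)).const_mul _) (ae_of_all _ fun x ↦ by positivity),
    integral_const_mul, integral_gaussian, ← Real.sqrt_inv, ← Real.sqrt_mul (by positivity)]
  congr 2
  field_simp

theorem lintegral_exp_sum_sq_gaussian (n : ℕ) (t : ℝ) (ht : -1 < t) :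
    ∫⁻ x : Fin n → ℝ, ENNReal.ofReal (Real.exp (-(t / 2) * ∑ i, x i ^ 2))
        ∂(Measure.pi fun _ ↦ gaussianReal 0 1) =
      ENNReal.ofReal (√(1 / (1 + t))) ^ n := by
  simp_rw [Finset.mul_sum, Real.exp_sum]
  simp_rw [fun x : Fin n → ℝ ↦ ENNReal.ofReal_prod_of_nonneg
    (fun i (_ : i ∈ Finset.univ) ↦ (Real.exp_pos (-(t / 2) * x i ^ 2)).le)]
  rw [lintegral_fin_prod_eq_prod (fun _ ↦ gaussianReal 0 1)
    (fun _ y ↦ ENNReal.ofReal (Real.exp (-(t / 2) * y ^ 2))) (fun _ ↦ by fun_prop)]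
  rw [Finset.prod_congr rfl fun i _ ↦ lintegral_exp_sq_gaussianReal t ht]
  simp

section

variable {E : Type*} [NormedAddCommGroup E] [InnerProductSpace ℝ E] [FiniteDimensional ℝ E]
  [MeasurableSpace E] [BorelSpace E]

theorem lintegral_exp_norm_sq_stdGaussian (t : ℝ) (ht : -1 < t) :
    ∫⁻ x, ENNReal.ofReal (Real.exp (-(t / 2) * ‖x‖ ^ 2)) ∂(stdGaussian E) =
      ENNReal.ofReal (√(1 / (1 + t))) ^ Module.finrank ℝ E := by
  rw [stdGaussian, lintegral_map (by fun_prop) (by fun_prop),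
    ← lintegral_exp_sum_sq_gaussian _ t ht]
  refine lintegral_congr fun x ↦ ?_
  have h := (stdOrthonormalBasis ℝ E).sum_sq_norm_inner_right
    (∑ i, x i • stdOrthonormalBasis ℝ E i)
  rw [← h]
  congr 4
  ext i
  rw [(stdOrthonormalBasis ℝ E).orthonormal.inner_right_fintype, Real.norm_eq_abs, sq_abs]

/-- The characteristic functions agree: a vector of `V` has the same inner product with a point and
with its projection. -/
theorem stdGaussian_map_orthogonalProjectionOnto (V : Submodule ℝ E) :
    (stdGaussian E).map V.orthogonalProjectionOnto = stdGaussian V := by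
  apply Measure.ext_of_charFun
  ext t
  rw [charFun_stdGaussian, charFun_apply, integral_map (by fun_prop) (by fun_prop)]
  have := charFun_stdGaussian (t : E)
  rw [charFun_apply] at this
  simp only [Submodule.coe_norm]
  rw [← this]
  refine integral_congr_ae (ae_of_all _ fun x ↦ ?_)
  simp only
  rw [Submodule.inner_orthogonalProjectionOnto_eq_of_mem_right]

/-- Chernoff bound for the squared norm of the projection of a standard Gaussian vector. -/
theorem stdGaussian_projection_tail (V : Submodule ℝ E) (x : ℝ) :
    stdGaussian E {z | x ≤ ‖V.orthogonalProjectionOnto z‖ ^ 2} ≤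
      ENNReal.ofReal (Real.exp (Module.finrank ℝ V - x / 4)) := by
  have h : stdGaussian E {z | x ≤ ‖V.orthogonalProjectionOnto z‖ ^ 2} =
      stdGaussian V {z | x ≤ ‖z‖ ^ 2} := by
    rw [← stdGaussian_map_orthogonalProjectionOnto, Measure.map_apply (by fun_prop)
      (measurableSet_le (by fun_prop) (by fun_prop))]
    rfl
  rw [h]
  -- Chernoff with tilt `t = -1/2`, that is weight `exp (‖z‖² / 4)`; its mean `√2 ^ dim` is relaxed
  -- to `e ^ dim`.
  have h2 : ∀ z : V, z ∈ {z : V | x ≤ ‖z‖ ^ 2} → ENNReal.ofReal (Real.exp (x / 4)) ≤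
      ENNReal.ofReal (Real.exp (-((-(1 / 2)) / 2) * ‖z‖ ^ 2)) := fun z hz ↦ by
    have : x ≤ ‖z‖ ^ 2 := hz
    gcongr
    linarith
  have h3 := mul_meas_ge_le_lintegral (μ := stdGaussian V)
    (f := fun z : V ↦ ENNReal.ofReal (Real.exp (-((-(1 / 2)) / 2) * ‖z‖ ^ 2))) (by fun_prop)
    (ENNReal.ofReal (Real.exp (x / 4)))
  rw [lintegral_exp_norm_sq_stdGaussian _ (by norm_num)] at h3
  have h4 : ENNReal.ofReal (√(1 / (1 + -(1 / 2)))) ^ Module.finrank ℝ V ≤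
      ENNReal.ofReal (Real.exp (Module.finrank ℝ V)) := by
    rw [← ENNReal.ofReal_pow (by positivity)]
    refine ENNReal.ofReal_le_ofReal ?_
    rw [← mul_one (Module.finrank ℝ V : ℝ), Real.exp_nat_mul]
    gcongr
    have : √(1 / (1 + -(1 / 2) : ℝ)) ≤ 2 := by
      rw [Real.sqrt_le_left (by norm_num)]; norm_num
    have := Real.add_one_le_exp (1 : ℝ)
    linarith
  have h5 : ENNReal.ofReal (Real.exp (x / 4)) * stdGaussian V {z | x ≤ ‖z‖ ^ 2} ≤
      ENNReal.ofReal (Real.exp (Module.finrank ℝ V)) :=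
    (mul_le_mul' le_rfl (measure_mono h2)).trans (h3.trans h4)
  rw [Real.exp_sub, ENNReal.ofReal_div_of_pos (Real.exp_pos _), ENNReal.le_div_iff_mul_le
    (Or.inl (by simpa using Real.exp_pos _)) (Or.inl ENNReal.ofReal_ne_top), mul_comm]
  exact h5

/-- Both tails of a `χ²` variable with `n` degrees of freedom are exponentially small. -/
theorem gaussian_sum_sq_tail (n : ℕ) :
    (Measure.pi fun _ : Fin n ↦ gaussianReal 0 1)
      {z | ∑ i, z i ^ 2 < n / 2 ∨ 2 * n < ∑ i, z i ^ 2} ≤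
      ENNReal.ofReal (2 * Real.exp (-(n / 12))) := by
  have hlog : 0.6931471803 < Real.log 2 := Real.log_two_gt_d9
  have hlog' : Real.log 2 < 0.6931471808 := Real.log_two_lt_d9
  have key : ∀ (t x : ℝ) (S : Set (Fin n → ℝ)), -1 < t →
      (∀ z ∈ S, x ≤ -(t / 2) * ∑ i, z i ^ 2) → -(1 / 2) * Real.log (1 + t) * n - x ≤ -(n / 12) →
      (Measure.pi fun _ : Fin n ↦ gaussianReal 0 1) S ≤ ENNReal.ofReal (Real.exp (-(n / 12))) := by
    intro t x S ht hS hx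
    have h3 := mul_meas_ge_le_lintegral (μ := Measure.pi fun _ : Fin n ↦ gaussianReal 0 1)
      (f := fun z : Fin n → ℝ ↦ ENNReal.ofReal (Real.exp (-(t / 2) * ∑ i, z i ^ 2)))
      (by fun_prop) (ENNReal.ofReal (Real.exp x))
    rw [lintegral_exp_sum_sq_gaussian _ _ ht] at h3
    have h4 : ENNReal.ofReal (√(1 / (1 + t))) ^ n =
        ENNReal.ofReal (Real.exp (-(1 / 2) * Real.log (1 + t) * n)) := by
      rw [← ENNReal.ofReal_pow (by positivity), mul_comm, Real.exp_nat_mul, Real.sqrt_eq_rpow,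
        Real.rpow_def_of_pos (by have : 0 < 1 + t := by linarith
                                 positivity), one_div, Real.log_inv]
      congr 3
      ring
    rw [h4] at h3
    refine le_trans ?_ (ENNReal.ofReal_le_ofReal (Real.exp_le_exp.2 hx))
    rw [Real.exp_sub, ENNReal.ofReal_div_of_pos (Real.exp_pos _), ENNReal.le_div_iff_mul_le
      (Or.inl (by simpa using Real.exp_pos _)) (Or.inl ENNReal.ofReal_ne_top), mul_comm]
    refine (mul_le_mul' le_rfl (measure_mono fun z hz ↦ ?_)).trans h3
    exact ENNReal.ofReal_le_ofReal (Real.exp_le_exp.2 (hS z hz))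
  have hn : (0 : ℝ) ≤ n := n.cast_nonneg
  rw [Set.ofPred_or, two_mul (Real.exp _), ENNReal.ofReal_add (by positivity) (by positivity)]
  refine (measure_union_le _ _).trans (add_le_add ?_ ?_)
  -- The lower tail uses `t = 1` and the rate `(log 2) / 2 - 1 / 4 > 1 / 12`; the upper tail uses `t
  -- = -1/2` and the rate `1 / 2 - (log 2) / 2`.
  · refine key 1 (-(n / 4)) _ (by norm_num) (fun z hz ↦ ?_) ?_
    · have : ∑ i, z i ^ 2 < n / 2 := hz
      linarith
    · norm_num
      nlinarith
  · refine key (-(1 / 2)) (n / 2) _ (by norm_num) (fun z hz ↦ ?_) ?_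
    · have : 2 * n < ∑ i, z i ^ 2 := hz
      linarith
    · have : (1 + -(1 / 2) : ℝ) = 2⁻¹ := by norm_num
      rw [this, Real.log_inv]
      nlinarith

end

/-! ### The regression map and spans of column blocks. -/

namespace Model

variable {T : ℕ} (m : Model T)

theorem mean_sub (θ θ' : m.Theta) : m.mean (θ - θ') = m.mean θ - m.mean θ' := by
  unfold mean
  rw [← Matrix.mulVec_sub]
  rfl

theorem measurable_mean : Measurable m.mean := by
  unfold mean
  refine measurable_pi_lambda _ fun t ↦ ?_
  simp only [Matrix.mulVec, dotProduct]
  fun_prop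

theorem predError_eq_norm_sq (θ θ' : m.Theta) :
    m.predError θ θ' = ‖WithLp.toLp 2 (m.mean (θ - θ'))‖ ^ 2 := by
  simp [predError, EuclideanSpace.real_norm_sq_eq]

theorem mean_eq_sum (θ : m.Theta) :
    m.mean θ = ∑ j, (m.Z.submatrix id
      (fun k : Fin (m.g j) => (⟨j, k⟩ : Σ j : Fin m.G, Fin (m.g j)))).mulVec (θ j) := by
  ext t
  simp [mean, Matrix.mulVec, dotProduct, Fintype.sum_sigma]

section
open scoped Matrix.Norms.L2Operator

theorem blockNorm_nonneg : 0 ≤ m.blockNorm := Real.iSup_nonneg fun _ ↦ norm_nonneg _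

theorem norm_mean_le (θ : m.Theta) :
    ‖WithLp.toLp 2 (m.mean θ)‖ ≤ m.blockNorm * ∑ j, ‖θ j‖ := by
  rw [mean_eq_sum, WithLp.toLp_sum, Finset.mul_sum]
  refine (norm_sum_le _ _).trans (Finset.sum_le_sum fun j _ ↦ ?_)
  refine (Matrix.l2_opNorm_mulVec _ (θ j)).trans ?_
  gcongr
  exact le_ciSup (f := fun j : Fin m.G ↦ ‖m.Z.submatrix id
    (fun k : Fin (m.g j) => (⟨j, k⟩ : Σ j : Fin m.G, Fin (m.g j)))‖)
    (Set.finite_range _).bddAbove j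

end

/-- The span of the columns of `Z` that belong to the groups `f 0, f 1, …`. -/
def colSpan {k : ℕ} (f : Fin k → Fin m.G) : Submodule ℝ (EuclideanSpace ℝ (Fin T)) :=
  Submodule.span ℝ (Set.range fun p : Σ i : Fin k, Fin (m.g (f i)) ↦
    WithLp.toLp 2 fun t ↦ m.Z t ⟨f p.1, p.2⟩)

theorem finrank_colSpan_le {k : ℕ} (f : Fin k → Fin m.G) :
    Module.finrank ℝ (m.colSpan f) ≤ ∑ i, m.g (f i) := by
  refine (finrank_range_le_card _).trans ?_
  simp

theorem mean_mem_colSpan {k : ℕ} (f : Fin k → Fin m.G) (θ : m.Theta)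
    (h : ∀ j, θ j ≠ 0 → j ∈ Set.range f) : WithLp.toLp 2 (m.mean θ) ∈ m.colSpan f := by
  have : WithLp.toLp 2 (m.mean θ) =
      ∑ j, ∑ k, (θ j k) • WithLp.toLp 2 fun t ↦ m.Z t (⟨j, k⟩ : Σ j : Fin m.G, Fin (m.g j)) := by
    ext t
    simp [mean, Matrix.mulVec, dotProduct, Fintype.sum_sigma, mul_comm]
  rw [this]
  refine Submodule.sum_mem _ fun j _ ↦ Submodule.sum_mem _ fun k _ ↦ ?_
  by_cases hj : θ j = 0
  · simp [hj]
  · obtain ⟨i, rfl⟩ := h j hj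
    exact Submodule.smul_mem _ _ (Submodule.subset_span ⟨⟨i, k⟩, rfl⟩)

end Model

/-- Repetitions are allowed, so sets of all sizes up to `k` are handled at once and the later union
bound runs over the `G ^ k` functions `Fin k → Fin G`. -/
theorem exists_range_superset {n k : ℕ} (hn : 0 < n) (S : Set (Fin n)) (hS : S.ncard ≤ k) :
    ∃ f : Fin k → Fin n, S ⊆ Set.range f := by
  have : Nonempty (Fin n) := ⟨⟨0, hn⟩⟩
  rcases S.eq_empty_or_nonempty with rfl | hne
  · exact ⟨fun _ ↦ ⟨0, hn⟩, by simp⟩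
  · classical
    have : Nonempty S := hne.to_subtype
    have hc : Fintype.card S ≤ Fintype.card (Fin k) := by
      rwa [Fintype.card_fin, ← Nat.card_eq_fintype_card]
    obtain ⟨e⟩ := Function.Embedding.nonempty_of_card_le hc
    refine ⟨fun i ↦ (Function.invFun e i : S), fun x hx ↦ ⟨e ⟨x, hx⟩, ?_⟩⟩
    exact congrArg Subtype.val (Function.leftInverse_invFun e.injective ⟨x, hx⟩)

/-! ### The Gaussian likelihood profiled over the variance. -/

/-- The Gaussian likelihood of `n` observations with variance `s` and residual sum of squares
`Q`. -/
noncomputable def gaussLik (n : ℕ) (s Q : ℝ) : ℝ :=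
  Real.exp (-(n / 2 * Real.log (2 * Real.pi * s)) - Q / (2 * s))

theorem gaussLik_pos (n : ℕ) (s Q : ℝ) : 0 < gaussLik n s Q := Real.exp_pos _

theorem gaussLik_anti (n : ℕ) {s Q Q' : ℝ} (hs : 0 < s) (h : Q ≤ Q') :
    gaussLik n s Q' ≤ gaussLik n s Q := by
  unfold gaussLik
  gcongr

/-- The likelihood is maximal at the variance `Q / n`. -/
theorem gaussLik_le_peak (n : ℕ) {s W : ℝ} (hs : 0 < s) (hW : 0 < W) :
    gaussLik n s (n * W) ≤ gaussLik n W (n * W) := by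
  unfold gaussLik
  have hn : (0 : ℝ) ≤ n := n.cast_nonneg
  have h1 : Real.log (W / s) ≤ W / s - 1 := Real.log_le_sub_one_of_pos (by positivity)
  rw [Real.log_div hW.ne' hs.ne'] at h1
  rw [Real.log_mul (by positivity) hs.ne', Real.log_mul (by positivity) hW.ne']
  refine Real.exp_le_exp.2 ?_
  have e1 : n * W / (2 * s) = n / 2 * (W / s) := by field_simp
  have e2 : n * W / (2 * W) = n / 2 := by field_simp
  rw [e1, e2]
  nlinarith [mul_le_mul_of_nonneg_left h1 (by positivity : (0 : ℝ) ≤ n / 2)]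

/-- The peak is proportional to `V ^ (-n / 2)`, so the ratio is `(1 + x / V) ^ (-n / 2)`, and `log
(1 + t) ≥ t / (1 + t) ≥ t / 2` for `0 ≤ t ≤ 1`. -/
theorem gaussLik_peak_add_le (n : ℕ) {V x : ℝ} (hV : 0 < V) (hx : 0 ≤ x) (hxV : x ≤ V) :
    gaussLik n (V + x) (n * (V + x)) ≤ gaussLik n V (n * V) * Real.exp (-(n * x / (4 * V))) := by
  unfold gaussLik
  have hn : (0 : ℝ) ≤ n := n.cast_nonneg
  have hW : 0 < V + x := by linarith
  rw [← Real.exp_add, Real.log_mul (by positivity) hW.ne', Real.log_mul (by positivity) hV.ne']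
  refine Real.exp_le_exp.2 ?_
  have h1 : 1 - ((V + x) / V)⁻¹ ≤ Real.log ((V + x) / V) :=
    Real.one_sub_inv_le_log_of_pos (by positivity)
  rw [Real.log_div hW.ne' hV.ne', inv_div] at h1
  have h2 : x / (2 * V) ≤ 1 - V / (V + x) := by
    rw [one_sub_div hW.ne', div_le_div_iff₀ (by positivity) hW]
    nlinarith
  have e1 : n * (V + x) / (2 * (V + x)) = n / 2 := by field_simp
  have e2 : n * V / (2 * V) = n / 2 := by field_simp
  have e3 : n * x / (4 * V) = n / 2 * (x / (2 * V)) := by field_simp; norm_num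
  rw [e1, e2, e3]
  nlinarith [mul_le_mul_of_nonneg_left (h2.trans h1) (by positivity : (0 : ℝ) ≤ n / 2)]

/-- Moving the variance up by `V / n` costs at most `1 / 2` in the normalising factor, and the
excess residual `V + 2` costs `1 / 2 + 1 / V`. -/
theorem le_gaussLik (n : ℕ) (hn : 1 ≤ n) {V s Q : ℝ} (hV : 0 < V) (hs : V ≤ s)
    (hs' : s ≤ V * (1 + 1 / n)) (hQ : Q ≤ n * V + V + 2) :
    gaussLik n V (n * V) * Real.exp (-(1 + 1 / V)) ≤ gaussLik n s Q := by
  have hn' : (0 : ℝ) < n := by exact_mod_cast hn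
  have hs0 : 0 < s := hV.trans_le hs
  refine le_trans ?_ (gaussLik_anti n hs0 hQ)
  unfold gaussLik
  rw [← Real.exp_add, Real.log_mul (by positivity) hV.ne', Real.log_mul (by positivity) hs0.ne']
  refine Real.exp_le_exp.2 ?_
  have h1 : Real.log (s / V) ≤ s / V - 1 := Real.log_le_sub_one_of_pos (by positivity)
  rw [Real.log_div hs0.ne' hV.ne'] at h1
  have h2 : s / V ≤ 1 + 1 / n := by
    rw [div_le_iff₀ hV]
    linarith
  have h3 : n / 2 * (Real.log s - Real.log V) ≤ 1 / 2 := by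
    calc _ ≤ (n : ℝ) / 2 * (1 / n) := by gcongr; linarith
      _ = 1 / 2 := by field_simp
  have h4 : (n * V + V + 2) / (2 * s) ≤ (n * V + V + 2) / (2 * V) := by gcongr
  have e : (n * V + V + 2) / (2 * V) = n * V / (2 * V) + 1 / 2 + 1 / V := by field_simp
  linarith

/-! ### The likelihood as a density of the data. -/

namespace Model

variable {T : ℕ} (m : Model T)

theorem likelihood_eq (y : Fin T → ℝ) (θ : m.Theta) {s : ℝ} (hs : 0 < s) :
    m.likelihood y θ s = ENNReal.ofReal (gaussLik T s (∑ t, (y t - m.mean θ t) ^ 2)) := by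
  unfold likelihood gaussianPDF gaussLik
  rw [← ENNReal.ofReal_prod_of_nonneg fun _ _ ↦ gaussianPDFReal_nonneg _ _ _]
  congr 1
  unfold gaussianPDFReal
  rw [Finset.prod_mul_distrib, ← Real.exp_sum, Real.coe_toNNReal _ hs.le, sub_eq_add_neg,
    Real.exp_add]
  congr 1
  · rw [Finset.prod_const, Finset.card_univ, Fintype.card_fin, Real.sqrt_eq_rpow,
      Real.rpow_def_of_pos (by positivity), ← Real.exp_neg, ← Real.exp_nat_mul]
    congr 1
    ring
  · rw [← Finset.sum_div, Finset.sum_neg_distrib, neg_div]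

/-- `Real.toNNReal` truncates `s` to the variance `0`, where the density is zero by convention. An
empty product would be `1`, hence `1 ≤ T`. -/
theorem likelihood_eq_zero (hT : 1 ≤ T) (y : Fin T → ℝ) (θ : m.Theta) {s : ℝ} (hs : s ≤ 0) :
    m.likelihood y θ s = 0 := by
  refine Finset.prod_eq_zero (Finset.mem_univ (⟨0, hT⟩ : Fin T)) ?_
  simp [Real.toNNReal_of_nonpos hs, gaussianPDF]

theorem measurable_likelihood :
    Measurable fun q : (Fin T → ℝ) × (m.Theta × ℝ) ↦ m.likelihood q.1 q.2.1 q.2.2 := by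
  unfold likelihood gaussianPDF
  refine Finset.measurable_prod _ fun t _ ↦ ENNReal.measurable_ofReal.comp ?_
  have h : Measurable fun q : (Fin T → ℝ) × (m.Theta × ℝ) ↦ m.mean q.2.1 t :=
    (measurable_pi_apply t).comp (m.measurable_mean.comp (by fun_prop))
  exact measurable_uncurry_gaussianPDFReal.comp
    (h.prodMk ((measurable_real_toNNReal.comp (by fun_prop)).prodMk (by fun_prop)))

theorem measurable_likelihood_left (θ : m.Theta) (s : ℝ) :
    Measurable fun y ↦ m.likelihood y θ s := by
  unfold likelihood
  exact Finset.measurable_prod _ fun t _ ↦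
    (measurable_gaussianPDF _ _).comp (measurable_pi_apply t)

theorem measurable_likelihood_right (y : Fin T → ℝ) :
    Measurable fun q : m.Theta × ℝ ↦ m.likelihood y q.1 q.2 := by
  have h := m.measurable_likelihood.comp (measurable_prodMk_left (x := y))
  rwa [Function.comp_def] at h

theorem lintegral_likelihood_le_one (θ : m.Theta) (s : ℝ) :
    ∫⁻ y, m.likelihood y θ s ≤ 1 := by
  unfold likelihood
  rw [volume_pi, lintegral_fin_prod_eq_prod (fun _ ↦ volume)
    (fun t x ↦ gaussianPDF (m.mean θ t) s.toNNReal x) fun _ ↦ measurable_gaussianPDF _ _]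
  refine Finset.prod_le_one' fun t _ ↦ ?_
  by_cases h : s.toNNReal = 0
  · simp [h, gaussianPDF]
  · rw [lintegral_gaussianPDF_eq_one _ h]

theorem dataLaw_eq_withDensity (θ : m.Theta) {s : ℝ} (hs : 0 < s) :
    m.dataLaw θ s = volume.withDensity fun y ↦ m.likelihood y θ s := by
  have hs' : s.toNNReal ≠ 0 := by simpa using hs
  unfold dataLaw likelihood
  have h : ∀ t, gaussianReal (m.mean θ t) s.toNNReal =
      volume.withDensity (gaussianPDF (m.mean θ t) s.toNNReal) := fun t ↦
    gaussianReal_of_var_ne_zero _ hs'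
  have : ∀ t, SigmaFinite (volume.withDensity (gaussianPDF (m.mean θ t) s.toNNReal)) :=
    fun t ↦ by rw [← h t]; infer_instance
  simp_rw [h]
  rw [pi_withDensity (fun _ ↦ volume) _ fun _ ↦ measurable_gaussianPDF _ _, volume_pi]

theorem dataLaw_eq_map (θ : m.Theta) {s : ℝ} (hs : 0 ≤ s) :
    m.dataLaw θ s = (Measure.pi fun _ : Fin T ↦ gaussianReal 0 1).map
      fun z t ↦ m.mean θ t + √s * z t := by
  have h : ∀ t, gaussianReal (m.mean θ t) s.toNNReal =
      (gaussianReal 0 1).map fun x ↦ m.mean θ t + √s * x := fun t ↦ by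
    have : (fun x ↦ m.mean θ t + √s * x) = (m.mean θ t + ·) ∘ (√s * ·) := rfl
    rw [this, ← Measure.map_map (by fun_prop) (by fun_prop), gaussianReal_map_const_mul,
      gaussianReal_map_const_add]
    congr 1
    · simp
    · ext
      simp [hs]
  unfold dataLaw
  simp_rw [h]
  have : ∀ t, SigmaFinite ((gaussianReal 0 1).map fun x ↦ m.mean θ t + √s * x) :=
    fun t ↦ by rw [← h t]; infer_instance
  rw [Measure.pi_map_pi (f := fun t x ↦ m.mean θ t + √s * x) fun t ↦ by fun_prop]

end Model

/-! ### The multi-Laplace, spike-and-slab, inverse Gamma and beta laws. -/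

/-- The second factor is the volume of the Euclidean unit ball. The identity gives both the total
mass of the multi-Laplace law and the `1 / n!` in its small-ball bound. -/
theorem laplaceConst_mul_volume {n : ℕ} (hn : 1 ≤ n) :
    Real.Gamma ((n : ℝ) / 2) / (2 * Real.pi ^ ((n : ℝ) / 2) * Real.Gamma n) *
      (√Real.pi ^ n / Real.Gamma ((n : ℝ) / 2 + 1)) = 1 / n.factorial := by
  have hn' : (0 : ℝ) < n := by exact_mod_cast hn
  have h1 : Real.pi ^ ((n : ℝ) / 2) = √Real.pi ^ n := by
    rw [Real.sqrt_eq_rpow, ← Real.rpow_natCast, ← Real.rpow_mul Real.pi_pos.le]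
    congr 1
    ring
  have h2 : (n.factorial : ℝ) = n * Real.Gamma n := by
    rw [← Real.Gamma_nat_eq_factorial, Real.Gamma_add_one hn'.ne']
  have h3 := Real.Gamma_pos_of_pos hn'
  have h4 := Real.Gamma_pos_of_pos (half_pos hn')
  have h5 : 0 < √Real.pi := Real.sqrt_pos.2 Real.pi_pos
  rw [h1, h2, Real.Gamma_add_one (half_pos hn').ne']
  field_simp

theorem integral_exp_neg_norm {n : ℕ} (hn : 1 ≤ n) :
    ∫ x : EuclideanSpace ℝ (Fin n), Real.exp (-‖x‖) =
      n.factorial * (√Real.pi ^ n / Real.Gamma ((n : ℝ) / 2 + 1)) := by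
  have hn' : (0 : ℝ) < n := by exact_mod_cast hn
  have : Nonempty (Fin n) := ⟨⟨0, hn⟩⟩
  have h1 := measure_unitBall_eq_integral_div_gamma
    (volume : Measure (EuclideanSpace ℝ (Fin n))) one_pos
  rw [EuclideanSpace.volume_ball] at h1
  simp only [Real.rpow_one, ENNReal.ofReal_one, one_pow, one_mul, Fintype.card_fin,
    finrank_euclideanSpace, div_one, Real.Gamma_nat_eq_factorial] at h1
  have h5 : 0 < √Real.pi := Real.sqrt_pos.2 Real.pi_pos
  have h4 := Real.Gamma_pos_of_pos (by positivity : 0 < (n : ℝ) / 2 + 1)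
  rw [ENNReal.ofReal_eq_ofReal_iff (by positivity)
    (div_nonneg (integral_nonneg fun x ↦ (Real.exp_pos _).le) (by positivity))] at h1
  rw [h1]
  field_simp

theorem lintegral_exp_neg_mul_norm {n : ℕ} (hn : 1 ≤ n) {ρ : ℝ} (hρ : 0 < ρ) :
    ∫⁻ x : EuclideanSpace ℝ (Fin n), ENNReal.ofReal (Real.exp (-ρ * ‖x‖)) =
      ENNReal.ofReal ((ρ ^ n)⁻¹ *
        (n.factorial * (√Real.pi ^ n / Real.Gamma ((n : ℝ) / 2 + 1)))) := by
  have h4 := Real.Gamma_pos_of_pos (by positivity : 0 < (n : ℝ) / 2 + 1)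
  have h5 : 0 < √Real.pi := Real.sqrt_pos.2 Real.pi_pos
  have h : ∫ x : EuclideanSpace ℝ (Fin n), Real.exp (-ρ * ‖x‖) = (ρ ^ n)⁻¹ *
        (n.factorial * (√Real.pi ^ n / Real.Gamma ((n : ℝ) / 2 + 1))) := by
    have := Measure.integral_comp_smul (volume : Measure (EuclideanSpace ℝ (Fin n)))
      (fun x ↦ Real.exp (-‖x‖)) ρ
    rw [integral_exp_neg_norm hn] at this
    simp only [norm_smul, Real.norm_eq_abs, abs_of_pos hρ, finrank_euclideanSpace,
      Fintype.card_fin, smul_eq_mul, abs_of_pos (inv_pos.2 (pow_pos hρ n))] at this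
    rw [← this]
    simp
  rw [← h, ofReal_integral_eq_lintegral_ofReal _ (ae_of_all _ fun x ↦ (Real.exp_pos _).le)]
  -- A non-integrable function would have integral `0`, against the positive value just computed.
  by_contra hi
  rw [integral_undef hi] at h
  have : 0 < (ρ ^ n)⁻¹ *
        (n.factorial * (√Real.pi ^ n / Real.Gamma ((n : ℝ) / 2 + 1))) := by positivity
  linarith

theorem multiLaplace_univ_le {n : ℕ} (hn : 1 ≤ n) {lam : ℝ} (hlam : 0 < lam) (s : ℝ) :
    multiLaplace n lam s Set.univ ≤ 1 := by
  have hn' : (0 : ℝ) < n := by exact_mod_cast hn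
  rw [multiLaplace, withDensity_apply _ MeasurableSet.univ, Measure.restrict_univ]
  -- For `s ≤ 0` the scale `lam / √s` is `0` by convention, and the density vanishes since `n ≠ 0`.
  rcases le_or_gt s 0 with hs | hs
  · simp [Real.sqrt_eq_zero_of_nonpos hs, (by lia : n ≠ 0)]
  · have hρ : 0 < lam / √s := div_pos hlam (Real.sqrt_pos.2 hs)
    have h3 := Real.Gamma_pos_of_pos hn'
    have h4 := Real.Gamma_pos_of_pos (half_pos hn')
    have h5 : 0 < √Real.pi := Real.sqrt_pos.2 Real.pi_pos
    have hc : 0 ≤ Real.Gamma ((n : ℝ) / 2) / (2 * Real.pi ^ ((n : ℝ) / 2) * Real.Gamma n)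
      * (lam / √s) ^ n := by positivity
    simp_rw [ENNReal.ofReal_mul hc]
    rw [lintegral_const_mul _ (by fun_prop), lintegral_exp_neg_mul_norm hn hρ,
      ← ENNReal.ofReal_mul hc, ← ENNReal.ofReal_one]
    refine ENNReal.ofReal_le_ofReal (le_of_eq ?_)
    have := laplaceConst_mul_volume hn
    calc _ = (Real.Gamma ((n : ℝ) / 2) / (2 * Real.pi ^ ((n : ℝ) / 2) * Real.Gamma n) *
      (√Real.pi ^ n / Real.Gamma ((n : ℝ) / 2 + 1))) * n.factorial * ((lam / √s) ^ n *
        ((lam / √s) ^ n)⁻¹) := by ring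
      _ = 1 := by
        rw [this, mul_inv_cancel₀ (pow_ne_zero _ hρ.ne')]
        field_simp

/-- On the ball the density is at least its value at norm `‖x‖ + r`; multiply by the volume. -/
theorem le_multiLaplace_ball {n : ℕ} (hn : 1 ≤ n) {lam s r : ℝ} (hlam : 0 < lam) (hs : 0 < s)
    (hr : 0 < r) (x : EuclideanSpace ℝ (Fin n)) :
    ENNReal.ofReal ((lam / √s * r) ^ n / n.factorial * Real.exp (-(lam / √s) * (‖x‖ + r))) ≤
      multiLaplace n lam s (Metric.ball x r) := by
  have hn' : (0 : ℝ) < n := by exact_mod_cast hn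
  have : Nonempty (Fin n) := ⟨⟨0, hn⟩⟩
  have hρ : 0 < lam / √s := div_pos hlam (Real.sqrt_pos.2 hs)
  have h3 := Real.Gamma_pos_of_pos hn'
  have h4 := Real.Gamma_pos_of_pos (half_pos hn')
  have h6 := Real.Gamma_pos_of_pos (by positivity : 0 < (n : ℝ) / 2 + 1)
  have h5 : 0 < √Real.pi := Real.sqrt_pos.2 Real.pi_pos
  rw [multiLaplace, withDensity_apply _ measurableSet_ball]
  have hle : ∫⁻ _ in Metric.ball x r, ENNReal.ofReal (Real.Gamma ((n : ℝ) / 2) /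
      (2 * Real.pi ^ ((n : ℝ) / 2) * Real.Gamma n)
      * (lam / √s) ^ n * Real.exp (-(lam / √s) * (‖x‖ + r))) ≤
      ∫⁻ x in Metric.ball x r, ENNReal.ofReal (Real.Gamma ((n : ℝ) / 2) /
      (2 * Real.pi ^ ((n : ℝ) / 2) * Real.Gamma n)
      * (lam / √s) ^ n * Real.exp (-(lam / √s) * ‖x‖)) := by
    refine setLIntegral_mono (by fun_prop) fun z hz ↦ ENNReal.ofReal_le_ofReal ?_
    have : ‖z‖ ≤ ‖x‖ + r := by
      have h1 : ‖z - x‖ < r := by simpa [dist_eq_norm] using hz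
      have h2 := norm_sub_norm_le z x
      linarith
    gcongr _ * Real.exp ?_
    nlinarith
  refine le_trans (le_of_eq ?_) hle
  rw [setLIntegral_const, EuclideanSpace.volume_ball, Fintype.card_fin,
    ← ENNReal.ofReal_pow hr.le, ← ENNReal.ofReal_mul (by positivity),
    ← ENNReal.ofReal_mul (by positivity)]
  congr 1
  have := laplaceConst_mul_volume hn
  calc _ = (1 / n.factorial) * (lam / √s) ^ n * r ^ n *
        Real.exp (-(lam / √s) * (‖x‖ + r)) := by rw [mul_pow]; ring
    _ = _ := by rw [← this]; ring

theorem measurable_multiLaplace_apply (n : ℕ) (lam : ℝ) {B : Set (EuclideanSpace ℝ (Fin n))}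
    (hB : MeasurableSet B) : Measurable fun s ↦ multiLaplace n lam s B := by
  unfold multiLaplace
  simp_rw [withDensity_apply _ hB]
  exact Measurable.lintegral_prod_right' (f := fun q : ℝ × EuclideanSpace ℝ (Fin n) ↦
    ENNReal.ofReal (Real.Gamma ((n : ℝ) / 2) / (2 * Real.pi ^ ((n : ℝ) / 2) * Real.Gamma n)
      * (lam / √q.1) ^ n * Real.exp (-(lam / √q.1) * ‖q.2‖))) (by fun_prop)

theorem spikeSlab_univ_le {n : ℕ} (hn : 1 ≤ n) {lam : ℝ} (hlam : 0 < lam) (s p : ℝ) :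
    spikeSlab n lam s p Set.univ ≤ ENNReal.ofReal (1 - p) + ENNReal.ofReal p := by
  simp only [spikeSlab, Measure.add_apply, Measure.smul_apply, smul_eq_mul, measure_univ, mul_one]
  gcongr
  exact mul_le_of_le_one_right' (multiLaplace_univ_le hn hlam s)

theorem spikeSlab_univ_le_one {n : ℕ} (hn : 1 ≤ n) {lam : ℝ} (hlam : 0 < lam) (s : ℝ) {p : ℝ}
    (hp : p ∈ Set.Ioo (0 : ℝ) 1) : spikeSlab n lam s p Set.univ ≤ 1 := by
  refine (spikeSlab_univ_le hn hlam s p).trans ?_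
  rw [← ENNReal.ofReal_add (by linarith [hp.2]) hp.1.le]
  simp

theorem spikeSlab_compl_zero_le {n : ℕ} (hn : 1 ≤ n) {lam : ℝ} (hlam : 0 < lam) (s p : ℝ) :
    spikeSlab n lam s p {0}ᶜ ≤ ENNReal.ofReal (1 - p) := by
  simp only [spikeSlab, Measure.add_apply, Measure.smul_apply, smul_eq_mul]
  rw [Measure.dirac_apply' _ (measurableSet_singleton _).compl]
  simp only [Set.mem_compl_iff, Set.mem_singleton_iff, not_true_eq_false, not_false_eq_true,
    Set.indicator_of_notMem, mul_zero, add_zero]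
  exact mul_le_of_le_one_right' ((measure_mono (Set.subset_univ _)).trans
    (multiLaplace_univ_le hn hlam s))

theorem le_spikeSlab_zero (n : ℕ) (lam s p : ℝ) :
    ENNReal.ofReal p ≤ spikeSlab n lam s p {0} := by
  simp only [spikeSlab, Measure.add_apply, Measure.smul_apply, smul_eq_mul]
  rw [Measure.dirac_apply' _ (measurableSet_singleton _)]
  simp

theorem le_spikeSlab (n : ℕ) (lam s p : ℝ) (B : Set (EuclideanSpace ℝ (Fin n))) :
    ENNReal.ofReal (1 - p) * multiLaplace n lam s B ≤ spikeSlab n lam s p B := by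
  simp only [spikeSlab, Measure.add_apply, Measure.smul_apply, smul_eq_mul]
  exact le_self_add

theorem isFiniteMeasure_spikeSlab {n : ℕ} (hn : 1 ≤ n) {lam : ℝ} (hlam : 0 < lam) (s p : ℝ) :
    IsFiniteMeasure (spikeSlab n lam s p) :=
  ⟨(spikeSlab_univ_le hn hlam s p).trans_lt (by simp)⟩

theorem measurable_spikeSlab_apply (n : ℕ) (lam : ℝ) {B : Set (EuclideanSpace ℝ (Fin n))}
    (hB : MeasurableSet B) : Measurable fun q : ℝ × ℝ ↦ spikeSlab n lam q.1 q.2 B := by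
  simp only [spikeSlab, Measure.add_apply, Measure.smul_apply, smul_eq_mul]
  have : Measurable fun q : ℝ × ℝ ↦ multiLaplace n lam q.1 B :=
    (measurable_multiLaplace_apply n lam hB).comp measurable_fst
  exact ((ENNReal.measurable_ofReal.comp (by fun_prop)).mul this).add
    ((ENNReal.measurable_ofReal.comp (by fun_prop)).mul measurable_const)

theorem measurable_invGammaPDF (a b : ℝ) : Measurable fun x : ℝ ↦
    ENNReal.ofReal (if 0 < x then b ^ a / Real.Gamma a * x ^ (-a - 1) * Real.exp (-b / x) else 0) :=
  ENNReal.measurable_ofReal.comp (Measurable.ite measurableSet_Ioi (by fun_prop) (by fun_prop))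

theorem invGamma_univ {a b : ℝ} (ha : 0 < a) (hb : 0 < b) : invGamma a b Set.univ = 1 := by
  have hG := Real.Gamma_pos_of_pos ha
  rw [invGamma, withDensity_apply _ MeasurableSet.univ, Measure.restrict_univ]
  have h1 : (fun x : ℝ ↦ ENNReal.ofReal
      (if 0 < x then b ^ a / Real.Gamma a * x ^ (-a - 1) * Real.exp (-b / x) else 0)) =
      (Set.Ioi 0).indicator fun x ↦ ENNReal.ofReal
        (b ^ a / Real.Gamma a * (x ^ (-a - 1) * Real.exp (-b / x))) := by
    ext x
    by_cases hx : 0 < x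
    · simp [hx, mul_assoc]
    · simp [hx]
  rw [h1, lintegral_indicator measurableSet_Ioi]
  have h2 : ∫ x in Set.Ioi (0 : ℝ), b ^ a / Real.Gamma a * (x ^ (-a - 1) * Real.exp (-b / x)) =
      1 := by
    rw [integral_const_mul]
    -- The substitution `y = x⁻¹` reduces the mass to a Gamma integral.
    have h3 := integral_comp_rpow_Ioi (fun y ↦ y ^ (a - 1) * Real.exp (-(b * y)))
      (by norm_num : (-1 : ℝ) ≠ 0)
    rw [Real.integral_rpow_mul_exp_neg_mul_Ioi ha hb] at h3
    have h4 : ∫ x in Set.Ioi (0 : ℝ), x ^ (-a - 1) * Real.exp (-b / x) =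
        (1 / b) ^ a * Real.Gamma a := by
      rw [← h3]
      refine setIntegral_congr_fun measurableSet_Ioi fun x hx ↦ ?_
      have hx' : (0 : ℝ) < x := hx
      simp only [abs_neg, abs_one, one_mul, smul_eq_mul]
      rw [← Real.rpow_mul hx'.le, ← mul_assoc, ← Real.rpow_add hx', Real.rpow_neg_one]
      congr 2
      · ring
      · rw [neg_div, div_eq_mul_inv]
    rw [h4, one_div, Real.inv_rpow hb.le]
    have := Real.rpow_pos_of_pos hb a
    field_simp
  have hint : IntegrableOn (fun x ↦ b ^ a / Real.Gamma a * (x ^ (-a - 1) * Real.exp (-b / x)))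
      (Set.Ioi 0) := by
    by_contra hi
    rw [integral_undef hi] at h2
    exact zero_ne_one h2
  have hnn : 0 ≤ᵐ[volume.restrict (Set.Ioi 0)]
      fun x ↦ b ^ a / Real.Gamma a * (x ^ (-a - 1) * Real.exp (-b / x)) := by
    refine (ae_restrict_iff' measurableSet_Ioi).2 (ae_of_all _ fun x hx ↦ ?_)
    have hx' : (0 : ℝ) < x := hx
    simp only [Pi.zero_apply]
    positivity
  have h5 := ofReal_integral_eq_lintegral_ofReal hint hnn
  rw [h2, ENNReal.ofReal_one] at h5
  exact h5.symm

theorem le_invGamma_Icc {a b V δ hi lo : ℝ} (ha : 0 < a) (hb : 0 < b) (hlo : 0 < lo)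
    (hV : lo ≤ V) (hδ : 0 ≤ δ) (hhi : V + δ ≤ hi) :
    ENNReal.ofReal (b ^ a / Real.Gamma a * hi ^ (-a - 1) * Real.exp (-b / lo) * δ) ≤
      invGamma a b (Set.Icc V (V + δ)) := by
  have hG := Real.Gamma_pos_of_pos ha
  have hhi0 : 0 < hi := by linarith
  rw [invGamma, withDensity_apply _ measurableSet_Icc]
  have : ∫⁻ _ in Set.Icc V (V + δ),
      ENNReal.ofReal (b ^ a / Real.Gamma a * hi ^ (-a - 1) * Real.exp (-b / lo)) ≤
      ∫⁻ x in Set.Icc V (V + δ), ENNReal.ofReal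
        (if 0 < x then b ^ a / Real.Gamma a * x ^ (-a - 1) * Real.exp (-b / x) else 0) := by
    refine setLIntegral_mono (measurable_invGammaPDF a b) fun x hx ↦ ENNReal.ofReal_le_ofReal ?_
    have hx0 : 0 < x := by linarith [hx.1]
    rw [if_pos hx0]
    have h1 : hi ^ (-a - 1) ≤ x ^ (-a - 1) :=
      Real.rpow_le_rpow_of_nonpos hx0 (hx.2.trans hhi) (by linarith)
    have h2 : -b / lo ≤ -b / x := by
      rw [neg_div, neg_div, neg_le_neg_iff]
      exact div_le_div_of_nonneg_left hb.le hlo (hV.trans hx.1)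
    gcongr
  refine le_trans (le_of_eq ?_) this
  rw [setLIntegral_const, Real.volume_Icc, add_sub_cancel_left, ENNReal.ofReal_mul (by positivity)]

theorem Gamma_add_natCast {x : ℝ} (hx : 0 < x) (n : ℕ) :
    Real.Gamma (x + n) = Real.Gamma x * ∏ i ∈ Finset.range n, (x + i) := by
  induction n with
  | zero => simp
  | succ n ih =>
    rw [Finset.prod_range_succ, ← mul_assoc, ← ih, Nat.cast_succ, ← add_assoc,
      Real.Gamma_add_one (by positivity), mul_comm]

/-- Conjugacy: the weighted density is a multiple of the one with parameters `c + a` and `d + b`,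
and the ratio of beta functions is a ratio of rising factorials. -/
theorem lintegral_pow_mul_pow_betaMeasure {c d : ℝ} (hc : 0 < c) (hd : 0 < d) (a b : ℕ) :
    ∫⁻ p, ENNReal.ofReal (p ^ a * (1 - p) ^ b) ∂(betaMeasure c d) =
      ENNReal.ofReal ((∏ i ∈ Finset.range a, (c + i)) * (∏ i ∈ Finset.range b, (d + i)) /
        ∏ i ∈ Finset.range (a + b), (c + d + i)) := by
  have hca : 0 < c + a := by positivity
  have hdb : 0 < d + b := by positivity
  rw [betaMeasure, lintegral_withDensity_eq_lintegral_mul _ (by unfold betaPDF; fun_prop)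
    (by fun_prop)]
  have h : ∀ p, (betaPDF c d * fun p ↦ ENNReal.ofReal (p ^ a * (1 - p) ^ b)) p =
      ENNReal.ofReal (beta (c + a) (d + b) / beta c d) * betaPDF (c + a) (d + b) p := by
    intro p
    rw [Pi.mul_apply]
    rcases le_or_gt p 0 with h0 | h0
    · rw [betaPDF_eq_zero_of_nonpos h0, betaPDF_eq_zero_of_nonpos h0]
      simp
    rcases le_or_gt 1 p with h1 | h1
    · rw [betaPDF_eq_zero_of_one_le h1, betaPDF_eq_zero_of_one_le h1]
      simp
    have hq : 0 < 1 - p := by linarith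
    have hb1 := beta_pos hc hd
    have hb2 := beta_pos hca hdb
    rw [betaPDF_of_pos_lt_one h0 h1, betaPDF_of_pos_lt_one h0 h1,
      ← ENNReal.ofReal_mul (by positivity), ← ENNReal.ofReal_mul (by positivity)]
    congr 1
    rw [show c + a - 1 = c - 1 + a by ring, show d + b - 1 = d - 1 + b by ring,
      Real.rpow_add_natCast h0.ne', Real.rpow_add_natCast hq.ne']
    field_simp
  simp_rw [h]
  rw [lintegral_const_mul _ (by unfold betaPDF; fun_prop), lintegral_betaPDF_eq_one hca hdb,
    mul_one]
  congr 1
  have g1 := Real.Gamma_pos_of_pos hc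
  have g2 := Real.Gamma_pos_of_pos hd
  have g3 := Real.Gamma_pos_of_pos (add_pos hc hd)
  have g4 : 0 < ∏ i ∈ Finset.range (a + b), (c + d + i) :=
    Finset.prod_pos fun i _ ↦ by positivity
  unfold beta
  rw [show c + a + (d + b) = c + d + (a + b : ℕ) by push_cast; ring,
    Gamma_add_natCast hc, Gamma_add_natCast hd, Gamma_add_natCast (add_pos hc hd)]
  field_simp

theorem ae_betaMeasure_mem_Ioo (c d : ℝ) : ∀ᵐ p ∂(betaMeasure c d), p ∈ Set.Ioo (0 : ℝ) 1 := by
  rw [betaMeasure, ae_withDensity_iff (by unfold betaPDF; fun_prop)]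
  refine ae_of_all _ fun p hp ↦ ⟨?_, ?_⟩
  · by_contra h
    exact hp (betaPDF_eq_zero_of_nonpos (not_lt.1 h))
  · by_contra h
    exact hp (betaPDF_eq_zero_of_one_le (not_lt.1 h))

/-! ### The joint prior: measurability, sparsity tails and mass near a sparse vector. -/

namespace Model

variable {T : ℕ} (m : Model T)

/-- The prior of the slopes given the variance and the spike probability. -/
noncomputable def slopePrior (q : ℝ × ℝ) : Measure m.Theta :=
  Measure.pi fun j ↦ spikeSlab (m.g j) (m.lam j) q.1 q.2

variable {m}

theorem slopePrior_pi (hg : ∀ j, 1 ≤ m.g j) (hl : ∀ j, 0 < m.lam j) (q : ℝ × ℝ)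
    (B : (j : Fin m.G) → Set (EuclideanSpace ℝ (Fin (m.g j)))) :
    m.slopePrior q (Set.univ.pi B) = ∏ j, spikeSlab (m.g j) (m.lam j) q.1 q.2 (B j) := by
  have := fun j ↦ isFiniteMeasure_spikeSlab (hg j) (hl j) q.1 q.2
  exact Measure.pi_pi _ _

theorem isFiniteMeasure_slopePrior (hg : ∀ j, 1 ≤ m.g j) (hl : ∀ j, 0 < m.lam j) (q : ℝ × ℝ) :
    IsFiniteMeasure (m.slopePrior q) := by
  have := fun j ↦ isFiniteMeasure_spikeSlab (hg j) (hl j) q.1 q.2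
  unfold slopePrior
  infer_instance

/-- Checking rectangles suffices because the measures are finite for every `q`, including spike
probabilities outside `(0, 1)`. Measurability is what gives access to the `bind` in the prior. -/
theorem measurable_slopePrior (hg : ∀ j, 1 ≤ m.g j) (hl : ∀ j, 0 < m.lam j) :
    Measurable m.slopePrior := by
  have := isFiniteMeasure_slopePrior hg hl
  have hrect : ∀ B : (j : Fin m.G) → Set (EuclideanSpace ℝ (Fin (m.g j))),
      (∀ j, MeasurableSet (B j)) → Measurable fun q ↦ m.slopePrior q (Set.univ.pi B) := by
    intro B hB
    simp_rw [slopePrior_pi hg hl]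
    exact Finset.measurable_prod _ fun j _ ↦ measurable_spikeSlab_apply _ _ (hB j)
  refine Measurable.measure_of_isPiSystem generateFrom_pi.symm isPiSystem_pi ?_ ?_
  · rintro _ ⟨B, hB, rfl⟩
    exact hrect B fun j ↦ hB j trivial
  · simpa using hrect (fun _ ↦ Set.univ) fun _ ↦ MeasurableSet.univ

theorem measurable_map_slopePrior (hg : ∀ j, 1 ≤ m.g j) (hl : ∀ j, 0 < m.lam j) :
    Measurable fun q : ℝ × ℝ ↦ (m.slopePrior q).map fun θ ↦ (θ, q.1) := by
  have := isFiniteMeasure_slopePrior hg hl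
  have hsmul : ∀ (A : Set m.Theta) (B : Set ℝ), MeasurableSet A → MeasurableSet B →
      Measurable fun q : ℝ × ℝ ↦ (m.slopePrior q).map (fun θ ↦ (θ, q.1)) (A ×ˢ B) := by
    intro A B hA hB
    have h : ∀ q : ℝ × ℝ, (m.slopePrior q).map (fun θ ↦ (θ, q.1)) (A ×ˢ B) =
        (Prod.fst ⁻¹' B).indicator (fun q ↦ m.slopePrior q A) q := by
      intro q
      rw [Measure.map_apply (by fun_prop) (hA.prod hB)]
      by_cases hq : q.1 ∈ B
      · rw [Set.indicator_of_mem (show q ∈ Prod.fst ⁻¹' B from hq)]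
        congr 1
        ext θ
        simp [hq]
      · rw [Set.indicator_of_notMem (show q ∉ Prod.fst ⁻¹' B from hq)]
        simp [hq]
    simp_rw [h]
    exact ((Measure.measurable_coe hA).comp (measurable_slopePrior hg hl)).indicator
      (measurable_fst hB)
  refine Measurable.measure_of_isPiSystem generateFrom_prod.symm isPiSystem_prod ?_ ?_
  · rintro _ ⟨A, hA, B, hB, rfl⟩
    exact hsmul A B hA hB
  · simpa using hsmul Set.univ Set.univ MeasurableSet.univ MeasurableSet.univ

theorem prior_eq_bind (a b : ℝ) : m.prior a b =
    ((invGamma a b).prod (betaMeasure m.c m.d)).bind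
      fun q ↦ (m.slopePrior q).map fun θ ↦ (θ, q.1) := rfl

theorem lintegral_prior (hg : ∀ j, 1 ≤ m.g j) (hl : ∀ j, 0 < m.lam j) (a b : ℝ)
    {F : m.Theta × ℝ → ℝ≥0∞} (hF : Measurable F) :
    ∫⁻ x, F x ∂(m.prior a b) =
      ∫⁻ q, ∫⁻ θ, F (θ, q.1) ∂(m.slopePrior q) ∂((invGamma a b).prod (betaMeasure m.c m.d)) := by
  rw [prior_eq_bind, Measure.lintegral_bind (measurable_map_slopePrior hg hl).aemeasurable hF.aemeasurable]
  exact lintegral_congr fun q ↦ lintegral_map hF (by fun_prop)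

theorem prior_apply (hg : ∀ j, 1 ≤ m.g j) (hl : ∀ j, 0 < m.lam j) (a b : ℝ)
    {A : Set (m.Theta × ℝ)} (hA : MeasurableSet A) :
    m.prior a b A = ∫⁻ q, m.slopePrior q {θ | (θ, q.1) ∈ A}
      ∂((invGamma a b).prod (betaMeasure m.c m.d)) := by
  rw [prior_eq_bind, Measure.bind_apply hA (measurable_map_slopePrior hg hl).aemeasurable]
  exact lintegral_congr fun q ↦ Measure.map_apply (by fun_prop) hA

theorem ae_mem_Ioo {a b : ℝ} (ha : 0 < a) (hb : 0 < b) (hc : 0 < m.c) (hd : 0 < m.d) :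
    ∀ᵐ q ∂((invGamma a b).prod (betaMeasure m.c m.d)), q.2 ∈ Set.Ioo (0 : ℝ) 1 := by
  have : IsProbabilityMeasure (invGamma a b) := ⟨invGamma_univ ha hb⟩
  have := isProbabilityMeasureBeta hc hd
  exact (Measure.quasiMeasurePreserving_snd).ae (ae_betaMeasure_mem_Ioo _ _)

theorem slopePrior_univ_le_one (hg : ∀ j, 1 ≤ m.g j) (hl : ∀ j, 0 < m.lam j) {q : ℝ × ℝ}
    (hq : q.2 ∈ Set.Ioo (0 : ℝ) 1) : m.slopePrior q Set.univ ≤ 1 := by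
  rw [← Set.pi_univ Set.univ, slopePrior_pi hg hl]
  exact Finset.prod_le_one' fun j _ ↦ spikeSlab_univ_le_one (hg j) (hl j) _ hq

theorem prior_univ_le_one (hg : ∀ j, 1 ≤ m.g j) (hl : ∀ j, 0 < m.lam j) {a b : ℝ}
    (ha : 0 < a) (hb : 0 < b) (hc : 0 < m.c) (hd : 0 < m.d) : m.prior a b Set.univ ≤ 1 := by
  have : IsProbabilityMeasure (invGamma a b) := ⟨invGamma_univ ha hb⟩
  have := isProbabilityMeasureBeta hc hd
  rw [prior_apply hg hl a b MeasurableSet.univ]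
  calc _ ≤ ∫⁻ _, 1 ∂((invGamma a b).prod (betaMeasure m.c m.d)) := by
        refine lintegral_mono_ae ((ae_mem_Ioo ha hb hc hd).mono fun q hq ↦ ?_)
        simpa using slopePrior_univ_le_one hg hl hq
    _ = 1 := by simp

theorem measurableSet_le_sparsity (k : ℕ) : MeasurableSet {θ : m.Theta | k ≤ m.sparsity θ} := by
  classical
  have h : ∀ θ : m.Theta, m.sparsity θ = ∑ j, if θ j ∈ ({0} : Set _)ᶜ then 1 else 0 := by
    intro θ
    rw [sparsity, Set.ncard_eq_toFinset_card', Finset.sum_boole]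
    simp [Set.toFinset_ofPred]
  have : Measurable m.sparsity := by
    rw [funext h]
    refine Finset.measurable_sum _ fun j _ ↦ ?_
    exact Measurable.ite ((measurableSet_singleton _).compl.preimage (measurable_pi_apply j))
      measurable_const measurable_const
  exact measurableSet_le measurable_const this

/-- Union bound over the possible sets of `k` nonzero groups. -/
theorem slopePrior_sparsity_le (hg : ∀ j, 1 ≤ m.g j) (hl : ∀ j, 0 < m.lam j) {q : ℝ × ℝ}
    (hq : q.2 ∈ Set.Ioo (0 : ℝ) 1) (k : ℕ) :
    m.slopePrior q {θ | k ≤ m.sparsity θ} ≤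
      (m.G.choose k : ℝ≥0∞) * ENNReal.ofReal ((1 - q.2) ^ k) := by
  classical
  let B (A : Finset (Fin m.G)) (j : Fin m.G) : Set (EuclideanSpace ℝ (Fin (m.g j))) :=
    if j ∈ A then {0}ᶜ else Set.univ
  have hsub : {θ | k ≤ m.sparsity θ} ⊆
      ⋃ A ∈ Finset.powersetCard k (Finset.univ : Finset (Fin m.G)), Set.univ.pi (B A) := by
    intro θ hθ
    have hθ' : k ≤ (Finset.univ.filter fun j ↦ θ j ≠ 0).card := by
      have : k ≤ m.sparsity θ := hθ
      rwa [sparsity, Set.ncard_eq_toFinset_card', Set.toFinset_ofPred] at this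
    obtain ⟨A, hA, hAk⟩ := Finset.exists_subset_card_eq hθ'
    simp only [Set.mem_iUnion]
    refine ⟨A, Finset.mem_powersetCard.2 ⟨Finset.subset_univ _, hAk⟩, fun j _ ↦ ?_⟩
    by_cases hj : j ∈ A
    · have := (Finset.mem_filter.1 (hA hj)).2
      simpa [B, hj] using this
    · simp [B, hj]
  refine (measure_mono hsub).trans ((measure_biUnion_finset_le _ _).trans ?_)
  have hle : ∀ A ∈ Finset.powersetCard k (Finset.univ : Finset (Fin m.G)),
      m.slopePrior q (Set.univ.pi (B A)) ≤ ENNReal.ofReal ((1 - q.2) ^ k) := by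
    intro A hA
    have hAk := (Finset.mem_powersetCard.1 hA).2
    rw [slopePrior_pi hg hl]
    calc _ ≤ ∏ j, if j ∈ A then ENNReal.ofReal (1 - q.2) else 1 := by
          refine Finset.prod_le_prod' fun j _ ↦ ?_
          by_cases hj : j ∈ A
          · simpa [B, hj] using spikeSlab_compl_zero_le (hg j) (hl j) q.1 q.2
          · simpa [B, hj] using spikeSlab_univ_le_one (hg j) (hl j) q.1 hq
      _ = ENNReal.ofReal ((1 - q.2) ^ k) := by
          rw [Finset.prod_ite_mem, Finset.univ_inter, Finset.prod_const, hAk,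
            ENNReal.ofReal_pow (by linarith [hq.2])]
  refine (Finset.sum_le_sum hle).trans ?_
  simp

/-- The conditional union bound does not involve the variance; averaging it over `π₀` leaves a beta
moment. -/
theorem prior_sparsity_le (hg : ∀ j, 1 ≤ m.g j) (hl : ∀ j, 0 < m.lam j) {a b : ℝ}
    (ha : 0 < a) (hb : 0 < b) (hc : 0 < m.c) (hd : 0 < m.d) (k : ℕ) :
    m.prior a b {q | k ≤ m.sparsity q.1} ≤
      ENNReal.ofReal (m.G.choose k * ((∏ i ∈ Finset.range k, (m.d + i)) /
        ∏ i ∈ Finset.range k, (m.c + m.d + i))) := by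
  have : IsProbabilityMeasure (invGamma a b) := ⟨invGamma_univ ha hb⟩
  have := isProbabilityMeasureBeta hc hd
  have hA : MeasurableSet {q : m.Theta × ℝ | k ≤ m.sparsity q.1} :=
    measurable_fst (measurableSet_le_sparsity k)
  rw [prior_apply hg hl a b hA]
  calc _ ≤ ∫⁻ q, (m.G.choose k : ℝ≥0∞) * ENNReal.ofReal ((1 - q.2) ^ k)
          ∂((invGamma a b).prod (betaMeasure m.c m.d)) :=
        lintegral_mono_ae ((ae_mem_Ioo ha hb hc hd).mono fun q hq ↦
          slopePrior_sparsity_le hg hl hq k)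
    _ = (m.G.choose k : ℝ≥0∞) * ∫⁻ p, ENNReal.ofReal (p ^ 0 * (1 - p) ^ k)
          ∂(betaMeasure m.c m.d) := by
        rw [lintegral_const_mul _ (by fun_prop), lintegral_prod _ (by fun_prop)]
        simp
    _ = _ := by
        rw [lintegral_pow_mul_pow_betaMeasure hc hd, ENNReal.ofReal_mul (by positivity),
          ENNReal.ofReal_natCast]
        simp

/-- A zero group contributes at least `p`, a nonzero one at least `(1 - p) κ`. Nonzero groups are
also charged a spare factor `p ≤ 1`, and the sparsity is raised to `k`, so that the bound depends on
`θ₀` only through `k`. -/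
theorem le_slopePrior_box (hg : ∀ j, 1 ≤ m.g j) (hl : ∀ j, 0 < m.lam j) {q : ℝ × ℝ}
    (hq : q.2 ∈ Set.Ioo (0 : ℝ) 1) (θ₀ : m.Theta) {k : ℕ} (hk : m.sparsity θ₀ ≤ k)
    {κ r : ℝ} (hκ0 : 0 ≤ κ) (hκ1 : κ ≤ 1) (hκ : ∀ j, θ₀ j ≠ 0 →
      ENNReal.ofReal κ ≤ multiLaplace (m.g j) (m.lam j) q.1 (Metric.ball (θ₀ j) r)) :
    ENNReal.ofReal (q.2 ^ m.G * (1 - q.2) ^ k) * ENNReal.ofReal (κ ^ k) ≤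
      m.slopePrior q {θ | ∀ j, (θ₀ j = 0 → θ j = 0) ∧ (θ₀ j ≠ 0 → ‖θ j - θ₀ j‖ < r)} := by
  classical
  let B (j : Fin m.G) : Set (EuclideanSpace ℝ (Fin (m.g j))) :=
    if θ₀ j = 0 then {0} else Metric.ball (θ₀ j) r
  have hB : {θ : m.Theta | ∀ j, (θ₀ j = 0 → θ j = 0) ∧ (θ₀ j ≠ 0 → ‖θ j - θ₀ j‖ < r)} =
      Set.univ.pi B := by
    ext θ
    simp only [Set.mem_ofPred_eq, Set.mem_univ_pi]
    refine forall_congr' fun j ↦ ?_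
    by_cases hj : θ₀ j = 0 <;> simp [B, hj, dist_eq_norm]
  have hp0 : 0 ≤ 1 - q.2 := by linarith [hq.2]
  rw [hB, slopePrior_pi hg hl, ← ENNReal.ofReal_mul (mul_nonneg (pow_nonneg hq.1.le _)
    (pow_nonneg hp0 _))]
  have hle : ∀ j, ENNReal.ofReal q.2 *
      (if θ₀ j ≠ 0 then ENNReal.ofReal ((1 - q.2) * κ) else 1) ≤
      spikeSlab (m.g j) (m.lam j) q.1 q.2 (B j) := by
    intro j
    by_cases hj : θ₀ j = 0
    · simpa [B, hj] using le_spikeSlab_zero (m.g j) (m.lam j) q.1 q.2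
    · simp only [ne_eq, hj, not_false_eq_true, if_true, B, if_false]
      refine le_trans ?_ (le_spikeSlab _ _ _ _ _)
      rw [ENNReal.ofReal_mul hp0]
      calc _ ≤ 1 * (ENNReal.ofReal (1 - q.2) * ENNReal.ofReal κ) := by
            gcongr
            exact ENNReal.ofReal_le_one.2 hq.2.le
        _ ≤ _ := by
            rw [one_mul]
            gcongr
            exact hκ j hj
  refine le_trans ?_ (Finset.prod_le_prod' fun j _ ↦ hle j)
  have hcard : (Finset.univ.filter fun j ↦ θ₀ j ≠ 0).card ≤ k := by
    rwa [sparsity, Set.ncard_eq_toFinset_card', Set.toFinset_ofPred] at hk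
  rw [Finset.prod_mul_distrib, Finset.prod_const, Finset.card_univ, Fintype.card_fin,
    Finset.prod_ite, Finset.prod_const_one, mul_one, Finset.prod_const,
    ← ENNReal.ofReal_pow hq.1.le, ← ENNReal.ofReal_pow (mul_nonneg hp0 hκ0),
    ← ENNReal.ofReal_mul (pow_nonneg hq.1.le _), mul_assoc, ← mul_pow]
  refine ENNReal.ofReal_le_ofReal (mul_le_mul_of_nonneg_left ?_ (pow_nonneg hq.1.le _))
  refine pow_le_pow_of_le_one (mul_nonneg hp0 hκ0) ?_ hcard
  nlinarith [hq.1]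

/-- Lower bound for a prior expectation, from a neighbourhood of `θ₀`. -/
theorem le_lintegral_prior (hg : ∀ j, 1 ≤ m.g j) (hl : ∀ j, 0 < m.lam j) {a b : ℝ}
    (ha : 0 < a) (hb : 0 < b) (hc : 0 < m.c) (hd : 0 < m.d) {F : m.Theta × ℝ → ℝ≥0∞}
    (hF : Measurable F) (θ₀ : m.Theta) {k : ℕ} (hk : m.sparsity θ₀ ≤ k) {I : Set ℝ}
    (hI : MeasurableSet I) {κ r : ℝ} (hκ0 : 0 ≤ κ) (hκ1 : κ ≤ 1)
    (hκ : ∀ s ∈ I, ∀ j, θ₀ j ≠ 0 →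
      ENNReal.ofReal κ ≤ multiLaplace (m.g j) (m.lam j) s (Metric.ball (θ₀ j) r))
    (ℓ : ℝ≥0∞) (hℓ : ∀ s ∈ I, ∀ θ : m.Theta,
      (∀ j, (θ₀ j = 0 → θ j = 0) ∧ (θ₀ j ≠ 0 → ‖θ j - θ₀ j‖ < r)) → ℓ ≤ F (θ, s)) :
    ℓ * ENNReal.ofReal (κ ^ k) * ENNReal.ofReal ((∏ i ∈ Finset.range m.G, (m.c + i)) *
      (∏ i ∈ Finset.range k, (m.d + i)) / ∏ i ∈ Finset.range (m.G + k), (m.c + m.d + i)) *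
      invGamma a b I ≤ ∫⁻ x, F x ∂(m.prior a b) := by
  have : IsProbabilityMeasure (invGamma a b) := ⟨invGamma_univ ha hb⟩
  have := isProbabilityMeasureBeta hc hd
  rw [lintegral_prior hg hl a b hF, ← lintegral_pow_mul_pow_betaMeasure hc hd]
  have hind : Measurable (I.indicator (1 : ℝ → ℝ≥0∞)) := measurable_one.indicator hI
  calc _ = ∫⁻ q, (ℓ * ENNReal.ofReal (κ ^ k)) * (I.indicator 1 q.1 *
          ENNReal.ofReal (q.2 ^ m.G * (1 - q.2) ^ k))
          ∂((invGamma a b).prod (betaMeasure m.c m.d)) := by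
        have hmeas : Measurable fun q : ℝ × ℝ ↦ (I.indicator 1 q.1 : ℝ≥0∞) *
            ENNReal.ofReal (q.2 ^ m.G * (1 - q.2) ^ k) :=
          (hind.comp measurable_fst).mul (by fun_prop)
        rw [lintegral_const_mul _ hmeas,
          lintegral_prod_mul (f := I.indicator 1)
            (g := fun p : ℝ ↦ ENNReal.ofReal (p ^ m.G * (1 - p) ^ k))
            hind.aemeasurable (by fun_prop), lintegral_indicator_one hI]
        ring
    _ ≤ _ := by
        -- For a variance in `I`, Markov's inequality at level `ℓ` reduces the inner integral to the
        -- mass of the box.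
        refine lintegral_mono_ae ((ae_mem_Ioo ha hb hc hd).mono fun q hq ↦ ?_)
        by_cases hqI : q.1 ∈ I
        · rw [Set.indicator_of_mem hqI, Pi.one_apply, one_mul]
          have h := le_slopePrior_box hg hl hq θ₀ hk hκ0 hκ1 (hκ q.1 hqI)
          calc _ = ℓ * (ENNReal.ofReal (q.2 ^ m.G * (1 - q.2) ^ k) * ENNReal.ofReal (κ ^ k)) := by
                ring
            _ ≤ ℓ * m.slopePrior q {θ | ∀ j, (θ₀ j = 0 → θ j = 0) ∧
                  (θ₀ j ≠ 0 → ‖θ j - θ₀ j‖ < r)} := by gcongr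
            _ ≤ ℓ * m.slopePrior q {θ | ℓ ≤ F (θ, q.1)} := by
                gcongr
                exact fun hθ ↦ hℓ q.1 hqI _ hθ
            _ ≤ _ := mul_meas_ge_le_lintegral (by fun_prop) _
        · rw [Set.indicator_of_notMem hqI]
          simp

end Model

/-! ### Projection geometry and change of measure. -/

/-- A vector of `V` only sees the projection of `e`, so the cross term is at most `2 ‖P e‖ ‖δ‖ ≤
‖δ‖² / 2`. -/
theorem norm_sq_add_le_norm_sub_sq {E : Type*} [NormedAddCommGroup E] [InnerProductSpace ℝ E]
    (V : Submodule ℝ E) [V.HasOrthogonalProjection] (e : E) {δ : E} (hδ : δ ∈ V)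
    (h : 16 * ‖V.orthogonalProjectionOnto e‖ ^ 2 ≤ ‖δ‖ ^ 2) :
    ‖e‖ ^ 2 + ‖δ‖ ^ 2 / 2 ≤ ‖e - δ‖ ^ 2 := by
  have h1 : inner ℝ e δ = inner ℝ (V.orthogonalProjectionOnto e : V) (⟨δ, hδ⟩ : V) :=
    (V.inner_orthogonalProjectionOnto_eq_of_mem_right (⟨δ, hδ⟩ : V) e).symm
  have h2 := real_inner_le_norm (V.orthogonalProjectionOnto e : V) (⟨δ, hδ⟩ : V)
  rw [← h1, Submodule.coe_norm ⟨δ, hδ⟩] at h2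
  have h3 : 4 * ‖V.orthogonalProjectionOnto e‖ ≤ ‖δ‖ :=
    abs_le_of_sq_le_sq' (by nlinarith) (norm_nonneg _) |>.2
  rw [norm_sub_sq_real]
  change inner ℝ e δ ≤ _ * ‖δ‖ at h2
  nlinarith [norm_nonneg δ]

/-- By Tonelli's theorem, the expectation of the integrated likelihood ratio over a set of
parameters is at most the mass of that set. -/
theorem lintegral_likelihoodRatio_le {Y Q : Type*} [MeasurableSpace Y] [MeasurableSpace Q]
    (ν : Measure Y) [SFinite ν] (μ : Measure Q) [SFinite μ] {L : Y → Q → ℝ≥0∞}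
    (hL : Measurable (Function.uncurry L)) (hL1 : ∀ q, ∫⁻ y, L y q ∂ν ≤ 1) {L₀ : Y → ℝ≥0∞}
    (hL₀ : Measurable L₀) (B : Set Q) {η : ℝ≥0∞} (hη0 : η ≠ 0) (hη : η ≠ ⊤) :
    ∫⁻ y, (η * L₀ y)⁻¹ * ∫⁻ q in B, L y q ∂μ ∂(ν.withDensity L₀) ≤ η⁻¹ * μ B := by
  have hmN : Measurable fun y ↦ ∫⁻ q in B, L y q ∂μ := hL.lintegral_prod_right'
  have hm : Measurable fun y ↦ (η * L₀ y)⁻¹ * ∫⁻ q in B, L y q ∂μ :=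
    (hL₀.const_mul _).inv.mul hmN
  rw [lintegral_withDensity_eq_lintegral_mul _ hL₀ hm]
  calc _ ≤ ∫⁻ y, η⁻¹ * ∫⁻ q in B, L y q ∂μ ∂ν := by
        refine lintegral_mono fun y ↦ ?_
        simp only [Pi.mul_apply]
        rw [ENNReal.mul_inv (Or.inl hη0) (Or.inl hη)]
        calc _ = (L₀ y)⁻¹ * L₀ y * (η⁻¹ * ∫⁻ q in B, L y q ∂μ) := by ring
          _ ≤ _ := mul_le_of_le_one_left' (ENNReal.inv_mul_le_one _)
    _ = η⁻¹ * ∫⁻ q in B, (∫⁻ y, L y q ∂ν) ∂μ := by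
        rw [lintegral_const_mul _ hmN, lintegral_lintegral_swap hL.aemeasurable]
    _ ≤ η⁻¹ * ∫⁻ _ in B, 1 ∂μ := by
        gcongr
        exact hL1 _
    _ = _ := by simp

/-! ### The posterior and the likelihood on the typical set. -/

namespace Model

variable {T : ℕ} {m : Model T}

/-- The residual sum of squares of `θ`. -/
noncomputable def rss (m : Model T) (y : Fin T → ℝ) (θ : m.Theta) : ℝ :=
  ∑ t, (y t - m.mean θ t) ^ 2

/-- The marginal density of the observations. -/
noncomputable def evidence (m : Model T) (a b : ℝ) (y : Fin T → ℝ) : ℝ≥0∞ :=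
  ∫⁻ q, m.likelihood y q.1 q.2 ∂(m.prior a b)

theorem rss_eq_norm_sq (y : Fin T → ℝ) (θ : m.Theta) :
    m.rss y θ = ‖WithLp.toLp 2 (y - m.mean θ)‖ ^ 2 := by
  simp [rss, EuclideanSpace.real_norm_sq_eq]

theorem rss_eq_norm_sub_sq (y : Fin T → ℝ) (θ θ₀ : m.Theta) :
    m.rss y θ =
      ‖WithLp.toLp 2 (y - m.mean θ₀) - WithLp.toLp 2 (m.mean (θ - θ₀))‖ ^ 2 := by
  rw [rss_eq_norm_sq, mean_sub, ← WithLp.toLp_sub]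
  congr 3
  abel

theorem measurable_rss (θ : m.Theta) : Measurable fun y ↦ m.rss y θ := by
  unfold rss
  fun_prop

/-- Finiteness of the prior removes any measurability requirement on `S`. -/
theorem posterior_apply {a b : ℝ} [IsFiniteMeasure (m.prior a b)] (y : Fin T → ℝ)
    (S : Set (m.Theta × ℝ)) : m.posterior a b y S =
      (m.evidence a b y)⁻¹ * ∫⁻ q in S, m.likelihood y q.1 q.2 ∂(m.prior a b) := by
  rw [posterior, Measure.smul_apply, withDensity_apply', smul_eq_mul, evidence]

theorem posterior_le_one {a b : ℝ} [IsFiniteMeasure (m.prior a b)] (y : Fin T → ℝ)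
    (S : Set (m.Theta × ℝ)) : m.posterior a b y S ≤ 1 := by
  rw [posterior_apply]
  calc _ ≤ (m.evidence a b y)⁻¹ * m.evidence a b y := by
        gcongr
        exact setLIntegral_le_lintegral _ _
    _ ≤ 1 := ENNReal.inv_mul_le_one _

/-- The prior predictive mass of a set of parameters bounds its expected posterior mass, relative
to a lower bound for the evidence. -/
theorem lintegral_posterior_le {a b : ℝ} [IsFiniteMeasure (m.prior a b)] (θ₀ : m.Theta) {v : ℝ}
    (hv : 0 < v) {E : Set (Fin T → ℝ)} {A B C : Set (m.Theta × ℝ)} (hABC : A ⊆ B ∪ C) {η β : ℝ≥0∞}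
    (hη0 : η ≠ 0) (hη : η ≠ ⊤)
    (hE : ∀ y ∈ E, η * m.likelihood y θ₀ v ≤ m.evidence a b y)
    (hC : ∀ y ∈ E, m.posterior a b y C ≤ β) :
    ∫⁻ y, m.posterior a b y A ∂(m.dataLaw θ₀ v) ≤
      m.dataLaw θ₀ v Eᶜ + β + η⁻¹ * m.prior a b B := by
  have hmL := m.measurable_likelihood_left θ₀ v
  have hmN : Measurable fun y ↦ (η * m.likelihood y θ₀ v)⁻¹ *
      ∫⁻ q in B, m.likelihood y q.1 q.2 ∂(m.prior a b) :=
    (hmL.const_mul η).inv.mul m.measurable_likelihood.lintegral_prod_right'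
  have hprob : IsProbabilityMeasure (m.dataLaw θ₀ v) := by unfold dataLaw; infer_instance
  have hpt : ∀ y, m.posterior a b y A ≤ (η * m.likelihood y θ₀ v)⁻¹ *
      -- On `E` the posterior mass is split over `B` and `C`; off `E` it is bounded by `1`.
      ∫⁻ q in B, m.likelihood y q.1 q.2 ∂(m.prior a b) + (β + Eᶜ.indicator 1 y) := by
    intro y
    by_cases hy : y ∈ E
    · refine (measure_mono hABC).trans ((measure_union_le _ _).trans ?_)
      refine add_le_add ?_ ((hC y hy).trans le_self_add)
      rw [posterior_apply]
      exact mul_le_mul' (ENNReal.inv_le_inv.2 (hE y hy)) le_rfl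
    · refine (posterior_le_one y A).trans ?_
      rw [Set.indicator_of_mem (show y ∈ Eᶜ from hy)]
      exact le_add_left (le_add_left le_rfl)
  refine (lintegral_mono hpt).trans ?_
  rw [lintegral_add_left hmN, lintegral_add_left measurable_const, lintegral_const, measure_univ,
    mul_one]
  have h1 : ∫⁻ y, Eᶜ.indicator 1 y ∂(m.dataLaw θ₀ v) ≤ m.dataLaw θ₀ v Eᶜ :=
    lintegral_indicator_one_le _
  have h2 : ∫⁻ y, (η * m.likelihood y θ₀ v)⁻¹ *
      ∫⁻ q in B, m.likelihood y q.1 q.2 ∂(m.prior a b) ∂(m.dataLaw θ₀ v) ≤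
      η⁻¹ * m.prior a b B := by
    rw [dataLaw_eq_withDensity _ _ hv]
    exact lintegral_likelihoodRatio_le volume (m.prior a b)
      (L := fun y q ↦ m.likelihood y q.1 q.2) m.measurable_likelihood
      (fun q ↦ m.lintegral_likelihood_le_one _ _) hmL B hη0 hη
  calc _ ≤ η⁻¹ * m.prior a b B + (β + m.dataLaw θ₀ v Eᶜ) :=
        add_le_add h2 (add_le_add le_rfl h1)
    _ = _ := by ring

/-- The event that the noise has the right size, and a small projection onto each span of at most
`k` groups of regressors. -/
def typicalSet (m : Model T) (θ₀ : m.Theta) (lo hi x : ℝ) (k : ℕ) : Set (Fin T → ℝ) :=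
  {y | T * lo / 2 ≤ m.rss y θ₀ ∧ m.rss y θ₀ ≤ 2 * T * hi ∧ ∀ f : Fin k → Fin m.G,
    ‖(m.colSpan f).orthogonalProjectionOnto (WithLp.toLp 2 (y - m.mean θ₀))‖ ^ 2 ≤ hi * x}

theorem measurableSet_typicalSet (θ₀ : m.Theta) (lo hi x : ℝ) (k : ℕ) :
    MeasurableSet (m.typicalSet θ₀ lo hi x k) := by
  have h := m.measurable_rss θ₀
  refine (measurableSet_le measurable_const h).inter ((measurableSet_le h measurable_const).inter ?_)
  have : {y | ∀ f : Fin k → Fin m.G, ‖(m.colSpan f).orthogonalProjectionOnto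
      (WithLp.toLp 2 (y - m.mean θ₀))‖ ^ 2 ≤ hi * x} = ⋂ f : Fin k → Fin m.G,
      {y | ‖(m.colSpan f).orthogonalProjectionOnto (WithLp.toLp 2 (y - m.mean θ₀))‖ ^ 2
        ≤ hi * x} := by
    ext; simp
  change MeasurableSet {y | ∀ f : Fin k → Fin m.G, ‖(m.colSpan f).orthogonalProjectionOnto
      (WithLp.toLp 2 (y - m.mean θ₀))‖ ^ 2 ≤ hi * x}
  rw [this]
  exact MeasurableSet.iInter fun f ↦ measurableSet_le (by fun_prop) measurable_const

/-- Chi-square tails control the size of the noise. The `G ^ k` spans have dimension at most `k γ`,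
so the projection bound and a union bound give the second term. -/
theorem dataLaw_compl_typicalSet_le (θ₀ : m.Theta) {lo hi v : ℝ} (hlo : 0 < lo) (hv : lo ≤ v)
    (hv' : v ≤ hi) {x : ℝ} (k : ℕ) {γ : ℝ} (hγ : ∀ j, (m.g j : ℝ) ≤ γ) :
    m.dataLaw θ₀ v (m.typicalSet θ₀ lo hi x k)ᶜ ≤
      ENNReal.ofReal (2 * Real.exp (-(T / 12))) +
        ENNReal.ofReal (m.G ^ k * Real.exp (k * γ - x / 4)) := by
  have hv0 : 0 < v := hlo.trans_le hv
  rw [dataLaw_eq_map _ _ hv0.le, Measure.map_apply (by fun_prop)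
    (measurableSet_typicalSet _ _ _ _ _).compl]
  have hT : (0 : ℝ) ≤ T := T.cast_nonneg
  have hsub : (fun (z : Fin T → ℝ) t ↦ m.mean θ₀ t + √v * z t) ⁻¹'
      (m.typicalSet θ₀ lo hi x k)ᶜ ⊆
      {z | ∑ i, z i ^ 2 < T / 2 ∨ 2 * T < ∑ i, z i ^ 2} ∪ ⋃ f : Fin k → Fin m.G,
        WithLp.toLp 2 ⁻¹' {z : EuclideanSpace ℝ (Fin T) |
          x ≤ ‖(m.colSpan f).orthogonalProjectionOnto z‖ ^ 2} := by
    intro z hz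
    by_contra hcon
    simp only [Set.mem_union, Set.mem_ofPred_eq, Set.mem_iUnion, Set.mem_preimage, not_or,
      not_lt, not_exists, not_le] at hcon
    obtain ⟨⟨h1, h2⟩, h3⟩ := hcon
    refine hz ?_
    have hrss : m.rss (fun t ↦ m.mean θ₀ t + √v * z t) θ₀ = v * ∑ i, z i ^ 2 := by
      simp only [rss, add_sub_cancel_left, mul_pow, Real.sq_sqrt hv0.le, Finset.mul_sum]
    have hsub : (fun t ↦ m.mean θ₀ t + √v * z t) - m.mean θ₀ = √v • z := by
      ext t
      simp
    refine ⟨?_, ?_, fun f ↦ ?_⟩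
    · rw [hrss]
      nlinarith
    · rw [hrss]
      have : 0 ≤ ∑ i, z i ^ 2 := Finset.sum_nonneg fun i _ ↦ sq_nonneg _
      nlinarith
    · rw [hsub, WithLp.toLp_smul, map_smul, norm_smul, mul_pow, Real.norm_eq_abs, sq_abs,
        Real.sq_sqrt hv0.le]
      exact mul_le_mul hv' (h3 f).le (sq_nonneg _) (hv0.le.trans hv')
  refine (measure_mono hsub).trans ((measure_union_le _ _).trans
    (add_le_add (gaussian_sum_sq_tail T) ?_))
  refine (measure_iUnion_fintype_le _ _).trans ?_
  have hf : ∀ f : Fin k → Fin m.G, (Measure.pi fun _ : Fin T ↦ gaussianReal 0 1)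
      (WithLp.toLp 2 ⁻¹' {z : EuclideanSpace ℝ (Fin T) |
          x ≤ ‖(m.colSpan f).orthogonalProjectionOnto z‖ ^ 2}) ≤
      ENNReal.ofReal (Real.exp (k * γ - x / 4)) := by
    intro f
    rw [← Measure.map_apply (by fun_prop) (measurableSet_le measurable_const (by fun_prop)),
      map_pi_eq_stdGaussian]
    refine (stdGaussian_projection_tail _ _).trans (ENNReal.ofReal_le_ofReal ?_)
    have h1 : (Module.finrank ℝ (m.colSpan f) : ℝ) ≤ ((∑ i, m.g (f i) : ℕ) : ℝ) := by
      exact_mod_cast m.finrank_colSpan_le f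
    have h2 : ((∑ i, m.g (f i) : ℕ) : ℝ) ≤ k * γ := by
      push_cast
      calc _ ≤ ∑ _ : Fin k, γ := Finset.sum_le_sum fun i _ ↦ hγ _
        _ = k * γ := by simp
    gcongr
    linarith
  refine (Finset.sum_le_sum fun f _ ↦ hf f).trans ?_
  rw [ENNReal.ofReal_mul (by positivity)]
  simp

/-- The support of `θ - θ₀` has at most `k` groups, so `Z (θ - θ₀)` lies in a span on which the
projected noise is small by typicality. -/
theorem rss_add_le {θ₀ θ : m.Theta} {lo hi x Q : ℝ} {k k₁ k₂ : ℕ} (hG : 0 < m.G)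
    (hk : k₁ + k₂ ≤ k) (h₀ : m.sparsity θ₀ ≤ k₁) (h : m.sparsity θ ≤ k₂)
    (hQ : Q ≤ m.predError θ θ₀) (hxQ : 16 * (hi * x) ≤ Q) {y : Fin T → ℝ}
    (hy : y ∈ m.typicalSet θ₀ lo hi x k) : m.rss y θ₀ + Q / 2 ≤ m.rss y θ := by
  obtain ⟨f, hf⟩ := exists_range_superset (k := k) hG ({j | θ₀ j ≠ 0} ∪ {j | θ j ≠ 0})
    ((Set.ncard_union_le _ _).trans ((add_le_add h₀ h).trans hk))
  have hmem : WithLp.toLp 2 (m.mean (θ - θ₀)) ∈ m.colSpan f := by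
    refine m.mean_mem_colSpan f _ fun j hj ↦ hf ?_
    by_contra hcon
    simp only [Set.mem_union, Set.mem_ofPred_eq, not_or, not_not] at hcon
    exact hj (by simp [hcon])
  rw [predError_eq_norm_sq] at hQ
  have := norm_sq_add_le_norm_sub_sq _ (WithLp.toLp 2 (y - m.mean θ₀)) hmem
    (by linarith [hy.2.2 f])
  rw [rss_eq_norm_sub_sq y θ θ₀, rss_eq_norm_sq y θ₀]
  linarith

/-- On the typical set the likelihood of sparse slopes far from `θ₀` is small. -/
theorem likelihood_le_of_mem_typicalSet {θ₀ θ : m.Theta} {lo hi x Q : ℝ} {k k₁ k₂ : ℕ}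
    (hT : 1 ≤ T) (hG : 0 < m.G) (hlo : 0 < lo)
    (hk : k₁ + k₂ ≤ k) (h₀ : m.sparsity θ₀ ≤ k₁) (h : m.sparsity θ ≤ k₂)
    (hQ : Q ≤ m.predError θ θ₀) (hQ0 : 0 ≤ Q) (hQT : Q ≤ T * lo) (hxQ : 16 * (hi * x) ≤ Q)
    {y : Fin T → ℝ} (hy : y ∈ m.typicalSet θ₀ lo hi x k) (s : ℝ) :
    m.likelihood y θ s ≤ ENNReal.ofReal
      (gaussLik T (m.rss y θ₀ / T) (T * (m.rss y θ₀ / T)) * Real.exp (-(Q / (16 * hi)))) := by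
  rcases le_or_gt s 0 with hs | hs
  · rw [likelihood_eq_zero _ hT _ _ hs]
    exact zero_le
  have hT0 : (0 : ℝ) < T := by exact_mod_cast hT
  set V := m.rss y θ₀ / T with hVdef
  have hrss : m.rss y θ₀ = T * V := by rw [hVdef]; field_simp
  have hV1 : lo / 2 ≤ V := by
    rw [hVdef, le_div_iff₀ hT0]
    linarith [hy.1]
  have hV2 : V ≤ 2 * hi := by
    rw [hVdef, div_le_iff₀ hT0]
    linarith [hy.2.1]
  have hV0 : 0 < V := by linarith
  have hx0 : 0 ≤ Q / (2 * T) := by positivity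
  have hxV : Q / (2 * T) ≤ V := by
    rw [div_le_iff₀ (by positivity)]
    nlinarith
  rw [likelihood_eq _ _ _ hs]
  refine ENNReal.ofReal_le_ofReal ?_
  have h1 := rss_add_le hG hk h₀ h hQ hxQ hy
  have h2 : T * (V + Q / (2 * T)) ≤ m.rss y θ := by
    have : T * (V + Q / (2 * T)) = T * V + Q / 2 := by field_simp
    linarith
  -- The residual mean square is at least `V + Q / (2 T)`. Maximising over the variance and
  -- comparing the two peaks loses `exp (-Q / (8 V))`, and `V ≤ 2 hi`.
  refine (gaussLik_anti T hs h2).trans ((gaussLik_le_peak T hs (by linarith)).trans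
    ((gaussLik_peak_add_le T hV0 hx0 hxV).trans ?_))
  refine mul_le_mul_of_nonneg_left (Real.exp_le_exp.2 (neg_le_neg ?_)) (gaussLik_pos _ _ _).le
  have : T * (Q / (2 * T)) / (4 * V) = Q / (8 * V) := by field_simp; ring
  rw [this]
  exact div_le_div_of_nonneg_left hQ0 (by linarith) (by linarith)

/-- Near `θ₀` the likelihood is comparable to its maximum. -/
theorem le_likelihood_of_mem_typicalSet {θ₀ θ : m.Theta} {lo hi x r s : ℝ} {k k₁ : ℕ}
    (hT : 1 ≤ T) (hlo : 0 < lo) (h₀ : m.sparsity θ₀ ≤ k₁) (hr : 0 ≤ r)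
    (hθ : ∀ j, (θ₀ j = 0 → θ j = 0) ∧ (θ₀ j ≠ 0 → ‖θ j - θ₀ j‖ < r))
    (hrad : m.blockNorm * (k₁ * r) * √T ≤ 1)
    {y : Fin T → ℝ} (hy : y ∈ m.typicalSet θ₀ lo hi x k)
    (hs : s ∈ Set.Icc (m.rss y θ₀ / T) (m.rss y θ₀ / T + m.rss y θ₀ / T / T)) :
    ENNReal.ofReal (gaussLik T (m.rss y θ₀ / T) (T * (m.rss y θ₀ / T)) *
      Real.exp (-(1 + 2 / lo))) ≤ m.likelihood y θ s := by
  classical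
  have hT0 : (0 : ℝ) < T := by exact_mod_cast hT
  set V := m.rss y θ₀ / T with hVdef
  have hrss : m.rss y θ₀ = T * V := by rw [hVdef]; field_simp
  have hV1 : lo / 2 ≤ V := by
    rw [hVdef, le_div_iff₀ hT0]
    linarith [hy.1]
  have hV0 : 0 < V := by linarith
  rw [likelihood_eq _ _ _ (hV0.trans_le hs.1)]
  refine ENNReal.ofReal_le_ofReal ?_
  have hδ : ‖WithLp.toLp 2 (m.mean (θ - θ₀))‖ * √T ≤ 1 := by
    refine le_trans (mul_le_mul_of_nonneg_right ((m.norm_mean_le _).trans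
      (mul_le_mul_of_nonneg_left ?_ m.blockNorm_nonneg)) (Real.sqrt_nonneg _)) hrad
    calc ∑ j, ‖(θ - θ₀) j‖ ≤ ∑ j, if θ₀ j ≠ 0 then r else 0 := by
          refine Finset.sum_le_sum fun j _ ↦ ?_
          by_cases hj : θ₀ j = 0
          · simp [hj, (hθ j).1 hj]
          · simpa [hj] using ((hθ j).2 hj).le
      _ = m.sparsity θ₀ * r := by
          rw [sparsity, Set.ncard_eq_toFinset_card', Set.toFinset_ofPred, ← Finset.sum_filter,
            Finset.sum_const, nsmul_eq_mul]
      _ ≤ k₁ * r := by gcongr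
  have hsq : √(T : ℝ) ^ 2 = T := Real.sq_sqrt hT0.le
  have hsT : 1 ≤ √(T : ℝ) := by
    rw [Real.one_le_sqrt]
    exact_mod_cast hT
  have hQ : m.rss y θ ≤ T * V + V + 2 := by
    rw [rss_eq_norm_sub_sq y θ θ₀]
    have h1 := norm_sub_le (WithLp.toLp 2 (y - m.mean θ₀)) (WithLp.toLp 2 (m.mean (θ - θ₀)))
    have h2 : ‖WithLp.toLp 2 (y - m.mean θ₀)‖ = √T * √V := by
      rw [← Real.sqrt_mul hT0.le, ← hrss, rss_eq_norm_sq, Real.sqrt_sq (norm_nonneg _)]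
    rw [h2] at h1
    set n := ‖WithLp.toLp 2 (m.mean (θ - θ₀))‖
    have hn : 0 ≤ n := norm_nonneg _
    have hV2 : √V ^ 2 = V := Real.sq_sqrt hV0.le
    have hVn := Real.sqrt_nonneg V
    have hn1 : n ≤ 1 := by nlinarith
    -- With `√T n ≤ 1` the cross term is at most `2 √V ≤ V + 1`, and `n² ≤ 1`; hence the excess `V +
    -- 2`.
    have h3 : √T * √V * n ≤ √V := by nlinarith
    calc _ ≤ (√T * √V + n) ^ 2 := by gcongr
      _ = T * V + 2 * (√T * √V * n) + n ^ 2 := by rw [add_sq, mul_pow, hsq, hV2]; ring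
      _ ≤ T * V + V + 2 := by nlinarith [sq_nonneg (√V - 1)]
  refine le_trans ?_ (le_gaussLik T hT hV0 hs.1 (by rw [mul_add, mul_one, mul_one_div]; exact hs.2)
    hQ)
  refine mul_le_mul_of_nonneg_left (Real.exp_le_exp.2 (neg_le_neg ?_)) (gaussLik_pos _ _ _).le
  have : 1 / V ≤ 2 / lo := by
    rw [div_le_div_iff₀ hV0 hlo]
    linarith
  linarith

/-- Turns an evidence bound relative to the peak into one relative to the true density, as the
Tonelli argument requires. -/
theorem likelihood_le_peak {θ₀ : m.Theta} {lo hi x v : ℝ} {k : ℕ} (hT : 1 ≤ T) (hlo : 0 < lo)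
    (hv : 0 < v) {y : Fin T → ℝ} (hy : y ∈ m.typicalSet θ₀ lo hi x k) :
    m.likelihood y θ₀ v ≤
      ENNReal.ofReal (gaussLik T (m.rss y θ₀ / T) (T * (m.rss y θ₀ / T))) := by
  have hT0 : (0 : ℝ) < T := by exact_mod_cast hT
  have hV1 : lo / 2 ≤ m.rss y θ₀ / T := by
    rw [le_div_iff₀ hT0]
    linarith [hy.1]
  rw [likelihood_eq _ _ _ hv]
  refine ENNReal.ofReal_le_ofReal (le_trans (le_of_eq ?_) (gaussLik_le_peak T hv (by linarith)))
  rw [mul_div_cancel₀ _ hT0.ne']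
  rfl

end Model

/-! ### Prior mass estimates in powers of the number of groups. -/

/-- The multi-Laplace mass of a small ball around a slope vector of moderate size is at least a
power of the number of groups. -/
theorem exp_neg_le_laplace_ball {n : ℕ} {T LG LT lo hi cg cθ clo Chi lam s s₀ B N : ℝ}
    (hT : 1 ≤ T) (hLT : LT = Real.log T) (hLT1 : 1 ≤ LT) (hLG : 1 ≤ LG) (hLGT : LG ≤ T)
    (hn : n * LT ≤ cg * LG) (hcg : 0 < cg) (hcgT : cg ≤ T) (hlo : 0 < lo)
    (hhiT : 2 * √hi ≤ T) (hs : lo / 2 ≤ s) (hs' : s ≤ 4 * hi) (hs₀ : 1 ≤ s₀) (hs₀T : s₀ ≤ T)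
    (hB : 0 < B) (hclo : 1 ≤ clo) (hChi : 0 < Chi) (hcθ : 0 < cθ)
    (hlam : B * clo / √T ≤ lam) (hlam₁ : lam ≤ Chi * √LT) (hlam₂ : lam ≤ Chi * (√LG * B))
    (hN : N ≤ √n * (cθ * √LG)) :
    Real.exp (-((5 * cg + Chi * (cθ * √cg + 1) / √(lo / 2)) * LG)) ≤
      (lam / √s * (1 / (s₀ * B * √T))) ^ n / n.factorial *
        Real.exp (-(lam / √s) * (N + 1 / (s₀ * B * √T))) := by
  have hT0 : 0 < T := by linarith
  have hsT : 1 ≤ √T := Real.one_le_sqrt.2 hT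
  have hs0 : 0 < s := by linarith
  have hlam0 : 0 < lam := lt_of_lt_of_le (by positivity) hlam
  have hss : √s ≤ 2 * √hi := by
    rw [show 2 * √hi = √(4 * hi) by
      rw [Real.sqrt_mul (by norm_num), show (4 : ℝ) = 2 ^ 2 by norm_num,
        Real.sqrt_sq (by norm_num)]]
    exact Real.sqrt_le_sqrt hs'
  have hss0 : 0 < √s := Real.sqrt_pos.2 hs0
  have hlo2 : 0 < √(lo / 2) := Real.sqrt_pos.2 (by linarith)
  have hsl : √(lo / 2) ≤ √s := Real.sqrt_le_sqrt hs
  set r := 1 / (s₀ * B * √T) with hr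
  have hr0 : 0 < r := by positivity
  -- The norm `B` in the lower bound on `lam` cancels the one in the radius, leaving only powers of
  -- `T`.
  have h1 : (T ^ 3)⁻¹ ≤ lam / √s * r := by
    calc (T ^ 3)⁻¹ = (1 / T) * (1 / (T * T)) := by field_simp
      _ ≤ (1 / √s) * (clo / (s₀ * T)) := by
          gcongr
          exact hss.trans hhiT
      _ = (B * clo / √T) / √s * r := by
          rw [hr]
          have : √T * √T = T := Real.mul_self_sqrt hT0.le
          field_simp
          nlinarith
      _ ≤ _ := by gcongr
  have hnT : (n : ℝ) ≤ T ^ 2 := by nlinarith [(Nat.cast_nonneg n : (0 : ℝ) ≤ n)]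
  have h2 : (n.factorial : ℝ) ≤ (T ^ 2) ^ n := by
    have : (n.factorial : ℝ) ≤ (n : ℝ) ^ n := by exact_mod_cast n.factorial_le_pow
    exact this.trans (by gcongr)
  -- Three powers of `T` per coordinate come from the radius and two from `n!`; `n log T ≤ cg log G`
  -- turns `T ^ (-5 n)` into a power of `G`.
  have h3 : Real.exp (-(5 * cg * LG)) ≤ (lam / √s * r) ^ n / n.factorial := by
    calc Real.exp (-(5 * cg * LG)) ≤ Real.exp (n * (-(5 * LT))) :=
          Real.exp_le_exp.2 (by linarith)
      _ = ((T ^ 5)⁻¹) ^ n := by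
          rw [Real.exp_nat_mul, Real.exp_neg]
          congr 2
          rw [show 5 * LT = (5 : ℕ) * LT by norm_num, Real.exp_nat_mul, hLT, Real.exp_log hT0]
      _ = ((T ^ 3)⁻¹) ^ n / (T ^ 2) ^ n := by
          rw [← div_pow]
          congr 1
          field_simp
      _ ≤ _ := by gcongr
  have hρ : lam / √s ≤ lam / √(lo / 2) := div_le_div_of_nonneg_left hlam0.le hlo2 hsl
  have hsLG : √LG ≤ LG := by
    rw [Real.sqrt_le_left (by linarith)]
    nlinarith
  have hsLG' : √LG * √LG = LG := Real.mul_self_sqrt (by linarith)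
  -- The two upper bounds on `lam` play different roles: `√LT` offsets the dimension factor `√n`
  -- here, and `√LG * B` offsets the `B` in `r` in the next estimate.
  have h4 : lam * (√n * (cθ * √LG)) ≤ Chi * (cθ * √cg) * LG := by
    have h41 : √LT * √n ≤ √cg * √LG := by
      rw [← Real.sqrt_mul (by linarith), ← Real.sqrt_mul hcg.le]
      exact Real.sqrt_le_sqrt (by linarith)
    calc _ ≤ Chi * √LT * (√n * (cθ * √LG)) := by gcongr
      _ = Chi * cθ * √LG * (√LT * √n) := by ring
      _ ≤ Chi * cθ * √LG * (√cg * √LG) := by gcongr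
      _ = Chi * (cθ * √cg) * (√LG * √LG) := by ring
      _ = _ := by rw [hsLG']
  have h5 : lam * r ≤ Chi * LG := by
    calc _ ≤ Chi * (√LG * B) * (1 / (1 * B * 1)) := by rw [hr]; gcongr
      _ = Chi * √LG := by field_simp
      _ ≤ _ := by gcongr
  have h6 : lam / √s * (N + r) ≤ Chi * (cθ * √cg + 1) / √(lo / 2) * LG := by
    calc _ ≤ lam / √s * (√n * (cθ * √LG) + r) := by gcongr
      _ ≤ lam / √(lo / 2) * (√n * (cθ * √LG) + r) := by gcongr
      _ = (lam * (√n * (cθ * √LG)) + lam * r) / √(lo / 2) := by ring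
      _ ≤ (Chi * (cθ * √cg) * LG + Chi * LG) / √(lo / 2) := by gcongr
      _ = _ := by ring
  calc _ ≤ Real.exp (-(5 * cg * LG)) * Real.exp (-(lam / √s) * (N + r)) := by
        rw [← Real.exp_add]
        refine Real.exp_le_exp.2 ?_
        linarith
    _ ≤ _ := by gcongr

/-- Lower bound for the expected probability, under a beta prior, of a given set of `k` nonzero
groups. -/
theorem exp_neg_le_beta_moment {c d δ cπ LG : ℝ} {G k : ℕ} (hc : (G : ℝ) ≤ c) (hG : 0 < G)
    (hδ : 0 < δ) (hδ1 : δ ≤ 1) (hδd : δ ≤ d) (hd : d ≤ k) (hk : k ≤ G) (hLG : 1 ≤ LG)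
    (hcπ : Real.log (G + c) ≤ cπ * LG) :
    Real.exp (-((3 - Real.log δ + cπ) * (k * LG))) ≤
      (∏ i ∈ Finset.range G, (c + i)) * (∏ i ∈ Finset.range k, (d + i)) /
        ∏ i ∈ Finset.range (G + k), (c + d + i) := by
  have hG' : (0 : ℝ) < G := by exact_mod_cast hG
  have hc0 : 0 < c := by linarith
  have hd0 : 0 < d := by linarith
  have hk' : (k : ℝ) ≤ G := by exact_mod_cast hk
  -- As `c ≥ G` and `d ≤ k`, adding `d` inflates each factor by at most `exp (k / G)`, in total by
  -- `exp k`.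
  have h1 : ∏ i ∈ Finset.range G, (c + d + i) ≤
      Real.exp k * ∏ i ∈ Finset.range G, (c + i) := by
    calc _ ≤ ∏ i ∈ Finset.range G, (Real.exp (k / G) * (c + i)) := by
          refine Finset.prod_le_prod (fun i _ ↦ by positivity) fun i _ ↦ ?_
          have h := Real.add_one_le_exp ((k : ℝ) / G)
          have hi : (0 : ℝ) ≤ i := i.cast_nonneg
          have : d ≤ k / G * (c + i) := by
            rw [div_mul_eq_mul_div, le_div_iff₀ hG']
            nlinarith
          nlinarith
      _ = _ := by
          rw [Finset.prod_mul_distrib, Finset.prod_const, Finset.card_range, ← Real.exp_nat_mul,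
            mul_div_cancel₀ _ hG'.ne']
  have h2 : Real.exp (k * Real.log δ) ≤ ∏ i ∈ Finset.range k, (d + i) := by
    rw [Real.exp_nat_mul, Real.exp_log hδ]
    calc δ ^ k = ∏ i ∈ Finset.range k, δ := by simp
      _ ≤ _ := Finset.prod_le_prod (fun _ _ ↦ hδ.le) fun i _ ↦ by
          have hi : (0 : ℝ) ≤ i := i.cast_nonneg
          linarith
  have h3 : ∏ i ∈ Finset.range k, (c + d + (G + i : ℕ)) ≤ Real.exp (k * (2 + cπ * LG)) := by
    rw [Real.exp_nat_mul]
    calc _ ≤ ∏ _ ∈ Finset.range k, Real.exp (2 + cπ * LG) := by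
          refine Finset.prod_le_prod (fun i _ ↦ by positivity) fun i hi ↦ ?_
          have hik : (i : ℝ) ≤ k := by exact_mod_cast (Finset.mem_range.1 hi).le
          have h3 : (3 : ℝ) ≤ Real.exp 2 := by
            have := Real.add_one_le_exp (2 : ℝ)
            linarith
          calc _ ≤ 3 * (G + c) := by push_cast; linarith
            _ = 3 * Real.exp (Real.log (G + c)) := by rw [Real.exp_log (by positivity)]
            _ ≤ Real.exp 2 * Real.exp (cπ * LG) := by gcongr
            _ = _ := by rw [Real.exp_add]
      _ = _ := by simp
  have hlog : Real.log δ ≤ 0 := Real.log_nonpos hδ.le hδ1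
  rw [Finset.prod_range_add, le_div_iff₀ (mul_pos (Finset.prod_pos fun i _ ↦ by positivity)
    (Finset.prod_pos fun i _ ↦ by positivity))]
  set P := ∏ i ∈ Finset.range G, (c + i)
  have hP : 0 ≤ P := Finset.prod_nonneg fun i _ ↦ by positivity
  calc _ ≤ Real.exp (-((3 - Real.log δ + cπ) * (k * LG))) *
        ((Real.exp k * P) * Real.exp (k * (2 + cπ * LG))) := by
        gcongr
    _ = P * Real.exp (-((3 - Real.log δ + cπ) * (k * LG)) + k + k * (2 + cπ * LG)) := by
        rw [Real.exp_add, Real.exp_add]; ring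
    _ ≤ P * Real.exp (k * Real.log δ) := by
        refine mul_le_mul_of_nonneg_left (Real.exp_le_exp.2 ?_) hP
        have hk0 : (0 : ℝ) ≤ k := k.cast_nonneg
        have a1 : (k : ℝ) ≤ k * LG := by nlinarith
        have a2 : k * LG * Real.log δ ≤ k * Real.log δ := by nlinarith
        nlinarith
    _ ≤ _ := by gcongr

/-- The number of nonzero groups has exponentially decreasing prior tails. -/
theorem choose_mul_beta_moment_le {c d u : ℝ} {G : ℕ} (hc : (G : ℝ) ≤ c) (hG : 0 < G) (hd : 0 < d)
    (h : ∀ j ∈ Finset.Icc 1 G,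
      (d + j - 1) / (c + G - j) ≤ j / ((G : ℝ) ^ u * (G - j + 1))) (k : ℕ) :
    G.choose k * ((∏ i ∈ Finset.range k, (d + i)) / ∏ i ∈ Finset.range k, (c + d + i)) ≤
      (2 / (G : ℝ) ^ u) ^ k := by
  have hG' : (0 : ℝ) < G := by exact_mod_cast hG
  have hc0 : 0 < c := by linarith
  have hGu : 0 < (G : ℝ) ^ u := Real.rpow_pos_of_pos hG' u
  induction k with
  | zero => simp
  | succ k ih =>
    rcases Nat.lt_or_ge k G with hk | hk
    · have hk' : (k : ℝ) + 1 ≤ G := by exact_mod_cast hk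
      have h1 := h (k + 1) (Finset.mem_Icc.2 ⟨by lia, hk⟩)
      push_cast at h1
      rw [div_le_div_iff₀ (by linarith) (mul_pos hGu (by linarith))] at h1
      have hch : (G.choose (k + 1) : ℝ) = G.choose k * ((G - k) / (k + 1)) := by
        have := Nat.choose_succ_right_eq G k
        rw [← mul_div_assoc, eq_div_iff (by positivity), ← Nat.cast_sub hk.le]
        exact_mod_cast this
      -- This is the ratio of consecutive terms. The condition at `j = k + 1` has `c + G - j` in
      -- place of `c + d + k`; `G ≤ c` makes the exchange cost the factor `2`.
      have hstep : ((G : ℝ) - k) / (k + 1) * ((d + k) / (c + d + k)) ≤ 2 / (G : ℝ) ^ u := by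
        rw [div_mul_div_comm, div_le_div_iff₀ (by positivity) hGu]
        have hk0 : (0 : ℝ) ≤ k := k.cast_nonneg
        have h2 : (k + 1) * (c + G - (k + 1)) ≤ (k + 1) * (2 * (c + d + k)) := by
          gcongr
          linarith
        nlinarith
      rw [Finset.prod_range_succ, Finset.prod_range_succ, hch, pow_succ, mul_div_mul_comm]
      calc _ = (G.choose k * ((∏ i ∈ Finset.range k, (d + i)) /
              ∏ i ∈ Finset.range k, (c + d + i))) *
              (((G : ℝ) - k) / (k + 1) * ((d + k) / (c + d + k))) := by ring
        _ ≤ _ := by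
          refine mul_le_mul ih hstep ?_ (by positivity)
          refine mul_nonneg (div_nonneg (by linarith) (by positivity)) (by positivity)
    · rw [Nat.choose_eq_zero_of_lt (by lia)]
      simp only [Nat.cast_zero, zero_mul]
      positivity

/-- At `j = 1` the condition reads `d G ^ u G ≤ c + G - 1`, and `d G ^ u ≥ 2`. -/
theorem card_le_of_beta_condition {c d dlo u : ℝ} {G : ℕ} (hG : 0 < G) (hc : 0 < c)
    (hd : dlo ≤ d) (hG2 : 2 ≤ dlo * (G : ℝ) ^ u)
    (h : ∀ j ∈ Finset.Icc 1 G,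
      (d + j - 1) / (c + G - j) ≤ j / ((G : ℝ) ^ u * (G - j + 1))) : (G : ℝ) ≤ c := by
  have hG' : (1 : ℝ) ≤ G := by exact_mod_cast hG
  have hGu : 0 < (G : ℝ) ^ u := Real.rpow_pos_of_pos (by linarith) u
  have h1 := h 1 (Finset.mem_Icc.2 ⟨le_rfl, hG⟩)
  rw [div_le_div_iff₀ (by push_cast; linarith) (mul_pos hGu (by push_cast; linarith))] at h1
  push_cast at h1
  have h2 : 2 * (G : ℝ) ≤ d * (G : ℝ) ^ u * G := by
    have : dlo * (G : ℝ) ^ u ≤ d * (G : ℝ) ^ u := by gcongr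
    nlinarith
  nlinarith

/-! ### Evidence lower bound and non-asymptotic contraction. -/

namespace Model

variable {T : ℕ} {m : Model T}

theorem norm_le_sqrt_mul_of_forall_abs_le {n : ℕ} {x : EuclideanSpace ℝ (Fin n)} {b : ℝ}
    (h : ∀ k, |x k| ≤ b) (hb : 0 ≤ b) : ‖x‖ ≤ √n * b := by
  rw [EuclideanSpace.norm_eq]
  refine Real.sqrt_le_iff.2 ⟨by positivity, ?_⟩
  rw [mul_pow, Real.sq_sqrt n.cast_nonneg]
  calc _ ≤ ∑ _ : Fin n, b ^ 2 := Finset.sum_le_sum fun k _ ↦ by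
        rw [Real.norm_eq_abs]
        exact pow_le_pow_left₀ (abs_nonneg _) (h k) 2
    _ = _ := by simp

/-- The variance window `[V, V + V / T]` moves with the data, but typicality keeps it inside `[lo /
2, 4 hi]`, where `κ` is uniform and the inverse Gamma density is bounded below. -/
theorem le_evidence (hg : ∀ j, 1 ≤ m.g j) (hl : ∀ j, 0 < m.lam j) {a b lo hi x κ r : ℝ}
    {k k₁ : ℕ} (ha : 0 < a) (hb : 0 < b) (hc : 0 < m.c) (hd : 0 < m.d) (hT : 1 ≤ T)
    (hlo : 0 < lo) {θ₀ : m.Theta} (h₀ : m.sparsity θ₀ ≤ k₁) (hr : 0 ≤ r)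
    (hrad : m.blockNorm * (k₁ * r) * √T ≤ 1) (hκ0 : 0 ≤ κ) (hκ1 : κ ≤ 1)
    (hκ : ∀ s ∈ Set.Icc (lo / 2) (4 * hi), ∀ j, θ₀ j ≠ 0 →
      ENNReal.ofReal κ ≤ multiLaplace (m.g j) (m.lam j) s (Metric.ball (θ₀ j) r))
    {y : Fin T → ℝ} (hy : y ∈ m.typicalSet θ₀ lo hi x k) :
    ENNReal.ofReal (gaussLik T (m.rss y θ₀ / T) (T * (m.rss y θ₀ / T)) *
      (Real.exp (-(1 + 2 / lo)) * κ ^ k₁ * ((∏ i ∈ Finset.range m.G, (m.c + i)) *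
      (∏ i ∈ Finset.range k₁, (m.d + i)) / ∏ i ∈ Finset.range (m.G + k₁), (m.c + m.d + i)) *
      (b ^ a / Real.Gamma a * (4 * hi) ^ (-a - 1) * Real.exp (-b / (lo / 2)) * (lo / 2 / T)))) ≤
      m.evidence a b y := by
  have hT0 : (0 : ℝ) < T := by exact_mod_cast hT
  have hT1 : (1 : ℝ) ≤ T := by exact_mod_cast hT
  have hV1 : lo / 2 ≤ m.rss y θ₀ / T := by
    rw [le_div_iff₀ hT0]
    linarith [hy.1]
  have hV2 : m.rss y θ₀ / T ≤ 2 * hi := by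
    rw [div_le_iff₀ hT0]
    linarith [hy.2.1]
  have hsub : m.rss y θ₀ / T + m.rss y θ₀ / T / T ≤ 4 * hi := by
    have : m.rss y θ₀ / T / T ≤ m.rss y θ₀ / T := div_le_self (by linarith) hT1
    linarith
  have h1 := le_lintegral_prior hg hl ha hb hc hd (m.measurable_likelihood_right y) θ₀ h₀
    (I := Set.Icc (m.rss y θ₀ / T) (m.rss y θ₀ / T + m.rss y θ₀ / T / T)) measurableSet_Icc
    hκ0 hκ1 (fun s hs ↦ hκ s ⟨hV1.trans hs.1, hs.2.trans hsub⟩)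
    (ENNReal.ofReal (gaussLik T (m.rss y θ₀ / T) (T * (m.rss y θ₀ / T)) *
      Real.exp (-(1 + 2 / lo))))
    (fun s hs θ hθ ↦ le_likelihood_of_mem_typicalSet hT hlo h₀ hr hθ hrad hy hs)
  refine le_trans ?_ h1
  have h2 := le_invGamma_Icc ha hb (by linarith : 0 < lo / 2) hV1
    (div_nonneg (by linarith) hT0.le : 0 ≤ m.rss y θ₀ / T / T) hsub
  have hG := Real.Gamma_pos_of_pos ha
  have hhi : 0 < hi := by linarith
  have hp := gaussLik_pos T (m.rss y θ₀ / T) (T * (m.rss y θ₀ / T))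
  have hprod : 0 ≤ (∏ i ∈ Finset.range m.G, (m.c + i)) *
      (∏ i ∈ Finset.range k₁, (m.d + i)) / ∏ i ∈ Finset.range (m.G + k₁), (m.c + m.d + i) := by
    refine div_nonneg (mul_nonneg ?_ ?_) ?_ <;> exact Finset.prod_nonneg fun i _ ↦ by positivity
  refine le_trans ?_ (mul_le_mul' le_rfl h2)
  generalize gaussLik T (m.rss y θ₀ / T) (T * (m.rss y θ₀ / T)) = p at hp ⊢
  generalize (∏ i ∈ Finset.range m.G, (m.c + i)) *
      (∏ i ∈ Finset.range k₁, (m.d + i)) /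
      ∏ i ∈ Finset.range (m.G + k₁), (m.c + m.d + i) = R at hprod ⊢
  rw [← ENNReal.ofReal_mul (by positivity), ← ENNReal.ofReal_mul (by positivity),
    ← ENNReal.ofReal_mul (by positivity)]
  refine ENNReal.ofReal_le_ofReal ?_
  calc _ = p * Real.exp (-(1 + 2 / lo)) * κ ^ k₁ * R * (b ^ a / Real.Gamma a *
        (4 * hi) ^ (-a - 1) * Real.exp (-b / (lo / 2)) * (lo / 2 / T)) := by ring
    _ ≤ _ := by gcongr

/-- Non-asymptotic contraction: the expected posterior mass of the slopes with large prediction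
error. -/
theorem lintegral_posterior_predError_le {a b lo hi v x Q W P : ℝ} {k k₁ k₂ : ℕ}
    (hprior : m.prior a b Set.univ ≤ 1)
    (hT : 1 ≤ T) (hG : 0 < m.G) (hlo : 0 < lo) (hv : lo ≤ v) (hv' : v ≤ hi)
    {θ₀ : m.Theta} (h₀ : m.sparsity θ₀ ≤ k₁) (hk : k₁ + k₂ ≤ k)
    (hQ0 : 0 ≤ Q) (hQT : Q ≤ T * lo) (hxQ : 16 * (hi * x) ≤ Q) {γ : ℝ}
    (hγ : ∀ j, (m.g j : ℝ) ≤ γ) (hW : 0 < W)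
    (hev : ∀ y ∈ m.typicalSet θ₀ lo hi x k, ENNReal.ofReal
      (gaussLik T (m.rss y θ₀ / T) (T * (m.rss y θ₀ / T)) * W) ≤ m.evidence a b y)
    (hP : m.prior a b {q | k₂ ≤ m.sparsity q.1} ≤ ENNReal.ofReal P) :
    ∫⁻ y, m.posterior a b y {q | Q ≤ m.predError q.1 θ₀} ∂(m.dataLaw θ₀ v) ≤
      ENNReal.ofReal (2 * Real.exp (-(T / 12))) +
      ENNReal.ofReal (m.G ^ k * Real.exp (k * γ - x / 4)) +
      ENNReal.ofReal (Real.exp (-(Q / (16 * hi))) / W) + ENNReal.ofReal (P / W) := by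
  have hv0 : 0 < v := hlo.trans_le hv
  have : IsFiniteMeasure (m.prior a b) := ⟨hprior.trans_lt ENNReal.one_lt_top⟩
  have hABC : {q : m.Theta × ℝ | Q ≤ m.predError q.1 θ₀} ⊆
      {q | k₂ ≤ m.sparsity q.1} ∪ {q | Q ≤ m.predError q.1 θ₀ ∧ m.sparsity q.1 ≤ k₂} := by
    intro q hq
    rcases le_total k₂ (m.sparsity q.1) with h | h
    · exact Or.inl h
    · exact Or.inr ⟨hq, h⟩
  refine (lintegral_posterior_le θ₀ hv0 hABC (E := m.typicalSet θ₀ lo hi x k)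
    (η := ENNReal.ofReal W) (β := ENNReal.ofReal (Real.exp (-(Q / (16 * hi))) / W))
    (by simpa using hW) ENNReal.ofReal_ne_top ?_ ?_).trans ?_
  · intro y hy
    refine le_trans ?_ (hev y hy)
    rw [mul_comm, ENNReal.ofReal_mul (gaussLik_pos _ _ _).le]
    gcongr
    exact likelihood_le_peak hT hlo hv0 hy
  · intro y hy
    have hp := gaussLik_pos T (m.rss y θ₀ / T) (T * (m.rss y θ₀ / T))
    rw [posterior_apply]
    calc _ ≤ (ENNReal.ofReal (gaussLik T (m.rss y θ₀ / T) (T * (m.rss y θ₀ / T)) * W))⁻¹ *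
          ∫⁻ _ in {q : m.Theta × ℝ | Q ≤ m.predError q.1 θ₀ ∧ m.sparsity q.1 ≤ k₂},
            ENNReal.ofReal (gaussLik T (m.rss y θ₀ / T) (T * (m.rss y θ₀ / T)) *
              Real.exp (-(Q / (16 * hi)))) ∂(m.prior a b) := by
          refine mul_le_mul' (ENNReal.inv_le_inv.2 (hev y hy)) ?_
          exact setLIntegral_mono measurable_const fun q hq ↦
            likelihood_le_of_mem_typicalSet hT hG hlo hk h₀ hq.2 hq.1 hQ0 hQT hxQ hy q.2
      _ ≤ (ENNReal.ofReal (gaussLik T (m.rss y θ₀ / T) (T * (m.rss y θ₀ / T)) * W))⁻¹ *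
            (ENNReal.ofReal (gaussLik T (m.rss y θ₀ / T) (T * (m.rss y θ₀ / T)) *
              Real.exp (-(Q / (16 * hi)))) * 1) := by
          rw [setLIntegral_const]
          gcongr
          exact (measure_mono (Set.subset_univ _)).trans hprior
      _ = _ := by
          rw [mul_one, ← ENNReal.ofReal_inv_of_pos (by positivity),
            ← ENNReal.ofReal_mul (by positivity)]
          generalize gaussLik T (m.rss y θ₀ / T) (T * (m.rss y θ₀ / T)) = p at hp
          congr 1
          field_simp
  · gcongr
    · exact dataLaw_compl_typicalSet_le θ₀ hlo hv hv' k hγ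
    · rw [div_eq_inv_mul, ENNReal.ofReal_mul (by positivity), ENNReal.ofReal_inv_of_pos hW]
      gcongr

end Model

/-! ### Contraction at a fixed sample size: the exponent budget. -/

namespace Model

variable {T : ℕ} {m : Model T}

/-- `T ε²` is the maximum of `s₀ log G` and `log T`. The upper bound by `s₀ log G` lets a sparsity
tail of that order beat any multiple of `T ε²`. -/
theorem rate_bounds {s₀ : ℕ} {D : ℝ} (hT : 1 ≤ T) (h1 : 1 ≤ D) (hD : Real.log T ≤ D * (s₀ * Real.log m.G)) :
    s₀ * Real.log m.G ≤ T * m.rate s₀ ^ 2 ∧ Real.log T ≤ T * m.rate s₀ ^ 2 ∧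
      T * m.rate s₀ ^ 2 ≤ D * (s₀ * Real.log m.G) := by
  have hT0 : (0 : ℝ) < T := by exact_mod_cast hT
  have hT1 : (1 : ℝ) ≤ T := by exact_mod_cast hT
  have hL : 0 ≤ s₀ * Real.log m.G := mul_nonneg s₀.cast_nonneg (Real.log_natCast_nonneg _)
  have hLT : 0 ≤ Real.log T := Real.log_nonneg hT1
  have ha : T * √(s₀ * Real.log m.G / T) ^ 2 = s₀ * Real.log m.G := by
    rw [Real.sq_sqrt (by positivity)]
    field_simp
  have hb : T * √(Real.log T / T) ^ 2 = Real.log T := by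
    rw [Real.sq_sqrt (by positivity)]
    field_simp
  unfold rate
  refine ⟨?_, ?_, ?_⟩
  · nth_rw 1 [← ha]
    gcongr
    exact le_max_left _ _
  · nth_rw 1 [← hb]
    gcongr
    exact le_max_right _ _
  · rcases max_choice √(s₀ * Real.log m.G / T) √(Real.log T / T) with h | h
    · rw [h, ha]
      nlinarith
    · rwa [h, hb]

/-- Lower bound for the evidence on the typical set. -/
theorem exp_neg_le_evidence
    {vlo vhi cg cθ clo Chi cπ dlo a b C₁ C₂ R x : ℝ} {s₀ k : ℕ}
    (hvlo : 0 < vlo) (hcg : 0 < cg) (hcθ : 0 < cθ) (hclo : 1 < clo) (hChi : 0 < Chi)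
    (hdlo : 0 < dlo) (ha : 0 < a) (hb : 0 < b)
    (hC₁ : C₁ = 3 - Real.log (min dlo 1) + cπ) (hC₁0 : 0 ≤ C₁)
    (hC₂ : C₂ = 5 * cg + Chi * (cθ * √cg + 1) / √(vlo / 2))
    (hs₀ : s₀ ≤ m.G) (hs1 : (1 : ℝ) ≤ s₀) (hg : ∀ j, 1 ≤ m.g j)
    (hgLT : ∀ j, m.g j * Real.log T ≤ cg * Real.log m.G) (hpen : m.Penalty clo Chi)
    (hB : 0 < m.blockNorm) (hdd : dlo ≤ m.d) (hds : m.d ≤ s₀) (hGc : (m.G : ℝ) ≤ m.c)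
    (hcG : Real.log (m.G + m.c) ≤ cπ * Real.log m.G)
    (hT : 1 ≤ T) (hTcg : cg ≤ T) (hTv : 2 * √vhi ≤ T) (hLT : 1 ≤ Real.log T)
    (hLG : 1 ≤ Real.log m.G) (hLGT : Real.log m.G ≤ T) (hsT : (s₀ : ℝ) ≤ T)
    (hR1 : s₀ * Real.log m.G ≤ R) (hR2 : Real.log T ≤ R)
    (hconst : Real.exp (-Real.log T) ≤ Real.exp (-(1 + 2 / vlo)) * (b ^ a / Real.Gamma a *
      (4 * vhi) ^ (-a - 1) * Real.exp (-b / (vlo / 2)) * (vlo / 2)))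
    {θ₀ : m.Theta} (hθ₀ : θ₀ ∈ m.trueSlopes cθ s₀) {y : Fin T → ℝ}
    (hy : y ∈ m.typicalSet θ₀ vlo vhi x k) :
    ENNReal.ofReal (gaussLik T (m.rss y θ₀ / T) (T * (m.rss y θ₀ / T)) *
      Real.exp (-((C₁ + C₂ + 2) * R))) ≤ m.evidence a b y := by
  have hT0 : (0 : ℝ) < T := by exact_mod_cast hT
  have hT1 : (1 : ℝ) ≤ T := by exact_mod_cast hT
  have hd : 0 < m.d := hdlo.trans_le hdd
  have hG : 0 < m.G := by
    have : 1 ≤ s₀ := by exact_mod_cast hs1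
    lia
  have hG' : (0 : ℝ) < m.G := by exact_mod_cast hG
  have hl : ∀ j, 0 < m.lam j := fun j ↦ (hpen.2 j).1
  have hsqT : 0 < √(T : ℝ) := Real.sqrt_pos.2 hT0
  have hC₂0 : 0 ≤ C₂ := by rw [hC₂]; positivity
  have hκ : ∀ s ∈ Set.Icc (vlo / 2) (4 * vhi), ∀ j, θ₀ j ≠ 0 →
      ENNReal.ofReal (Real.exp (-(C₂ * Real.log m.G))) ≤ multiLaplace (m.g j) (m.lam j) s
        (Metric.ball (θ₀ j) (1 / (s₀ * m.blockNorm * √T))) := by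
    intro s hs j _
    refine le_trans (ENNReal.ofReal_le_ofReal ?_)
      (le_multiLaplace_ball (hg j) (hl j) (by linarith [hs.1]) (by positivity) _)
    rw [hC₂]
    exact exp_neg_le_laplace_ball hT1 rfl hLT hLG hLGT (hgLT j) hcg hTcg hvlo hTv hs.1 hs.2
      hs1 hsT hB hclo.le hChi hcθ (hpen.2 j).2.1
      ((hpen.2 j).2.2.trans (mul_le_mul_of_nonneg_left (min_le_left _ _) hChi.le))
      ((hpen.2 j).2.2.trans (mul_le_mul_of_nonneg_left (min_le_right _ _) hChi.le))
      (norm_le_sqrt_mul_of_forall_abs_le (hθ₀.2 j) (by positivity))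
  have hrad : m.blockNorm * (s₀ * (1 / (s₀ * m.blockNorm * √T))) * √T ≤ 1 :=
    le_of_eq (by field_simp)
  have hmain := le_evidence hg hl ha hb (hG'.trans_le hGc) hd hT hvlo hθ₀.1 (by positivity) hrad
    (Real.exp_pos _).le (Real.exp_le_one_iff.2 (neg_nonpos.2 (by positivity))) hκ hy
  refine le_trans (ENNReal.ofReal_le_ofReal ?_) hmain
  refine mul_le_mul_of_nonneg_left ?_ (gaussLik_pos _ _ _).le
  have h1 := exp_neg_le_beta_moment (G := m.G) (k := s₀) (δ := min dlo 1) hGc hG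
    (lt_min hdlo one_pos) (min_le_right _ _) ((min_le_left _ _).trans hdd) hds hs₀ hLG hcG
  rw [← hC₁] at h1
  have h2 : 0 ≤ Real.exp (-(1 + 2 / vlo)) * (b ^ a / Real.Gamma a *
      (4 * vhi) ^ (-a - 1) * Real.exp (-b / (vlo / 2)) * (vlo / 2)) :=
    (Real.exp_pos _).le.trans hconst
  have h3 : Real.exp (-Real.log T) = 1 / T := by rw [Real.exp_neg, Real.exp_log hT0, one_div]
  -- The budget: `C₂ R` for the balls, `C₁ R` for the beta moment, one `R` for the window length `1
  -- / T`, and one for the fixed constants, which exceed `1 / T`.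
  have h4 : Real.exp (-((C₁ + C₂ + 2) * R)) ≤
      Real.exp (-Real.log T) * Real.exp (-(C₂ * Real.log m.G)) ^ s₀ *
        Real.exp (-(C₁ * (s₀ * Real.log m.G))) * Real.exp (-Real.log T) := by
    rw [← Real.exp_nat_mul, ← Real.exp_add, ← Real.exp_add, ← Real.exp_add]
    refine Real.exp_le_exp.2 ?_
    linarith [mul_le_mul_of_nonneg_left hR1 hC₁0, mul_le_mul_of_nonneg_left hR1 hC₂0]
  generalize (∏ i ∈ Finset.range m.G, (m.c + i)) * (∏ i ∈ Finset.range s₀, (m.d + i)) /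
      ∏ i ∈ Finset.range (m.G + s₀), (m.c + m.d + i) = B at h1 ⊢
  calc _ ≤ _ := h4
    _ ≤ (Real.exp (-(1 + 2 / vlo)) * (b ^ a / Real.Gamma a *
          (4 * vhi) ^ (-a - 1) * Real.exp (-b / (vlo / 2)) * (vlo / 2))) *
          Real.exp (-(C₂ * Real.log m.G)) ^ s₀ * B * (1 / T) := by
        rw [← h3]
        refine mul_le_mul_of_nonneg_right ?_ (Real.exp_pos _).le
        refine mul_le_mul ?_ h1 (Real.exp_pos _).le (mul_nonneg h2 (by positivity))
        exact mul_le_mul_of_nonneg_right hconst (by positivity)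
    _ = _ := by ring

/-- Exponential prior tails of the number of nonzero groups. -/
theorem prior_sparsity_le_exp {a b u H : ℝ} (hg : ∀ j, 1 ≤ m.g j) (hl : ∀ j, 0 < m.lam j)
    (ha : 0 < a) (hb : 0 < b) (hd : 0 < m.d) (hG : 0 < m.G) (hGc : (m.G : ℝ) ≤ m.c)
    (hcond : ∀ j ∈ Finset.Icc 1 m.G,
      (m.d + j - 1) / (m.c + m.G - j) ≤ j / ((m.G : ℝ) ^ u * (m.G - j + 1)))
    (hu : 0 < u) (hHu : Real.log 2 ≤ u / 2 * H) (hH : H ≤ Real.log m.G) (k : ℕ) :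
    m.prior a b {q | k ≤ m.sparsity q.1} ≤
      ENNReal.ofReal (Real.exp (-(u / 2 * k * Real.log m.G))) := by
  have hG' : (0 : ℝ) < m.G := by exact_mod_cast hG
  have hGu : (m.G : ℝ) ^ u = Real.exp (u * Real.log m.G) := by
    rw [Real.rpow_def_of_pos hG', mul_comm]
  refine (prior_sparsity_le hg hl ha hb (hG'.trans_le hGc) hd _).trans
    (ENNReal.ofReal_le_ofReal ?_)
  refine (choose_mul_beta_moment_le hGc hG hd hcond _).trans ?_
  -- Half of the exponent `u` absorbs the factor `2`.
  have h1 : 2 / (m.G : ℝ) ^ u ≤ Real.exp (-(u / 2 * Real.log m.G)) := by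
    rw [hGu, div_le_iff₀ (Real.exp_pos _), ← Real.exp_add,
      show -(u / 2 * Real.log m.G) + u * Real.log m.G = u / 2 * Real.log m.G by ring]
    calc (2 : ℝ) = Real.exp (Real.log 2) := (Real.exp_log two_pos).symm
      _ ≤ _ := Real.exp_le_exp.2
        (hHu.trans (mul_le_mul_of_nonneg_left hH (by positivity)))
  calc _ ≤ Real.exp (-(u / 2 * Real.log m.G)) ^ k := by
        have : 0 < (m.G : ℝ) ^ u := Real.rpow_pos_of_pos hG' u
        gcongr
    _ = _ := by
        rw [← Real.exp_nat_mul]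
        congr 1
        ring

/-- Posterior contraction at a fixed sample size. -/
theorem lintegral_posterior_le_of_conditions
    {vlo vhi cg cθ clo Chi cπ u dlo a b M H C₁ C₂ : ℝ} {s₀ K : ℕ}
    (hvlo : 0 < vlo) (hv : vlo ≤ vhi) (hcg : 0 < cg) (hcθ : 0 < cθ)
    (hclo : 1 < clo) (hChi : clo < Chi) (hcπ : 0 < cπ) (hu : 0 < u) (hdlo : 0 < dlo)
    (ha : 0 < a) (hb : 0 < b)
    (hC₁ : C₁ = 3 - Real.log (min dlo 1) + cπ)
    (hC₂ : C₂ = 5 * cg + Chi * (cθ * √cg + 1) / √(vlo / 2))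
    (hK : (C₁ + C₂ + 3) * max 1 cg ≤ u / 2 * K)
    (hM₁ : 16 * vhi * (4 * ((K + 1) * (1 + cg) + 1)) ≤ M)
    (hM₂ : 16 * vhi * (C₁ + C₂ + 3) ≤ M)
    (hH : 1 ≤ H) (hHu : Real.log 2 ≤ u / 2 * H) (hHd : 2 ≤ dlo * Real.exp (u * H))
    (hs₀ : s₀ ≤ m.G) (hgroup : m.GroupSize cg) (hpen : m.Penalty clo Chi)
    (hbeta : m.BetaHyper s₀ u cπ dlo)
    (hT : 1 ≤ T) (hTcg : cg ≤ T) (hTv : 2 * √vhi ≤ T) (hLT : 1 ≤ Real.log T)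
    (hLTH : cg * H ≤ Real.log T) (hrate : m.rate s₀ ≤ 1) (hrateM : M * m.rate s₀ ^ 2 ≤ vlo)
    (hconst : Real.exp (-Real.log T) ≤ Real.exp (-(1 + 2 / vlo)) * (b ^ a / Real.Gamma a *
      (4 * vhi) ^ (-a - 1) * Real.exp (-b / (vlo / 2)) * (vlo / 2)))
    {θ₀ : m.Theta} (hθ₀ : θ₀ ∈ m.trueSlopes cθ s₀) {v : ℝ} (hv₀ : v ∈ Set.Icc vlo vhi) :
    ∫⁻ y, m.posterior a b y {q | M * T * m.rate s₀ ^ 2 ≤ m.predError q.1 θ₀}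
        ∂(m.dataLaw θ₀ v) ≤
      ENNReal.ofReal (2 * Real.exp (-(T / 12)) + 3 * Real.exp (-Real.log T)) := by
  obtain ⟨hc, hdd, hds, hcond, hcG⟩ := hbeta
  have hd : 0 < m.d := hdlo.trans_le hdd
  have hT0 : (0 : ℝ) < T := by exact_mod_cast hT
  have hT1 : (1 : ℝ) ≤ T := by exact_mod_cast hT
  have hvhi : 0 < vhi := by linarith
  have hs1 : (1 : ℝ) ≤ s₀ := by
    have : (0 : ℝ) < s₀ := by linarith
    exact_mod_cast this
  have hG : 0 < m.G := by
    have : 1 ≤ s₀ := by exact_mod_cast hs1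
    lia
  have hG' : (0 : ℝ) < m.G := by exact_mod_cast hG
  have hg : ∀ j, 1 ≤ m.g j := fun j ↦ (hgroup j).1
  have hl : ∀ j, 0 < m.lam j := fun j ↦ (hpen.2 j).1
  have hLT0 : 0 < Real.log T := by linarith
  have hgLT : ∀ j, m.g j * Real.log T ≤ cg * Real.log m.G := fun j ↦ by
    have := (hgroup j).2
    rwa [le_div_iff₀ hLT0] at this
  -- Since groups are nonempty, the upper bound on their size forces `G` to grow polynomially in
  -- `T`.
  have hLTLG : Real.log T ≤ cg * Real.log m.G := by
    have h1 := hgLT ⟨0, hG⟩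
    have h2 : (1 : ℝ) ≤ m.g ⟨0, hG⟩ := by exact_mod_cast hg ⟨0, hG⟩
    exact (le_mul_of_one_le_left hLT0.le h2).trans h1
  have hHLG : H ≤ Real.log m.G := le_of_mul_le_mul_left (hLTH.trans hLTLG) hcg
  have hLG : 1 ≤ Real.log m.G := hH.trans hHLG
  have hexpLG : Real.exp (Real.log m.G) = m.G := Real.exp_log hG'
  have hGu : (m.G : ℝ) ^ u = Real.exp (u * Real.log m.G) := by
    rw [Real.rpow_def_of_pos hG', mul_comm]
  have hsLG : Real.log m.G ≤ s₀ * Real.log m.G := le_mul_of_one_le_left (by linarith) hs1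
  have hD1 : 1 ≤ max 1 cg := le_max_left _ _
  have hD2 : cg ≤ max 1 cg := le_max_right _ _
  obtain ⟨hR1, hR2, hR3⟩ := rate_bounds (m := m) (s₀ := s₀) (D := max 1 cg) hT hD1 (by
      calc Real.log T ≤ cg * Real.log m.G := hLTLG
        _ ≤ max 1 cg * (s₀ * Real.log m.G) := by gcongr)
  obtain ⟨R, hRdef⟩ : ∃ R, R = T * m.rate s₀ ^ 2 := ⟨_, rfl⟩
  rw [← hRdef] at hR1 hR2 hR3
  have hRT : R ≤ T := by
    have h0 : 0 ≤ m.rate s₀ := le_max_of_le_left (Real.sqrt_nonneg _)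
    have : m.rate s₀ ^ 2 ≤ 1 := pow_le_one₀ h0 hrate
    rw [hRdef]
    exact mul_le_of_le_one_right hT0.le this
  have hLGT : Real.log m.G ≤ T := by linarith
  have hsT : (s₀ : ℝ) ≤ T := (le_mul_of_one_le_right (by linarith) hLG).trans (hR1.trans hRT)
  have hR0 : 0 < R := by linarith
  have hlogδ : Real.log (min dlo 1) ≤ 0 :=
    Real.log_nonpos (le_min hdlo.le zero_le_one) (min_le_right _ _)
  have hC₁0 : 0 ≤ C₁ := by linarith
  have hChi0 : 0 < Chi := by linarith
  have hC₂0 : 0 ≤ C₂ := by rw [hC₂]; positivity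
  -- If the norm vanished, the upper bound on the penalties would contradict their positivity.
  have hB : 0 < m.blockNorm := by
    refine lt_of_le_of_ne m.blockNorm_nonneg fun h ↦ ?_
    have h1 := (hpen.2 ⟨0, hG⟩).2.2
    rw [← h, mul_zero] at h1
    have h2 : min √(Real.log T) 0 ≤ 0 := min_le_right _ _
    exact absurd (hl ⟨0, hG⟩)
      (not_lt.2 (h1.trans (mul_nonpos_of_nonneg_of_nonpos hChi0.le h2)))
  have hcG' : (m.G : ℝ) ≤ m.c := by
    refine card_le_of_beta_condition hG hc hdd (hHd.trans ?_) hcond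
    rw [hGu]
    gcongr
  have hθ₀s : m.sparsity θ₀ ≤ s₀ := hθ₀.1
  have hev : ∀ y ∈ m.typicalSet θ₀ vlo vhi (4 * ((K + 1) * (1 + cg) + 1) * R) (s₀ + K * s₀),
      ENNReal.ofReal (gaussLik T (m.rss y θ₀ / T) (T * (m.rss y θ₀ / T)) *
        Real.exp (-((C₁ + C₂ + 2) * R))) ≤ m.evidence a b y := by
    intro y hy
    exact exp_neg_le_evidence hvlo hcg hcθ hclo hChi0 hdlo ha hb hC₁ hC₁0 hC₂ hs₀ hs1 hg hgLT hpen
      hB hdd hds hcG' hcG hT hTcg hTv hLT hLG hLGT hsT hR1 hR2 hconst hθ₀ hy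
  have hP : m.prior a b {q | K * s₀ ≤ m.sparsity q.1} ≤
      ENNReal.ofReal (Real.exp (-((C₁ + C₂ + 3) * R))) := by
    refine (prior_sparsity_le_exp hg hl ha hb hd hG hcG' hcond hu hHu hHLG (K * s₀)).trans
      (ENNReal.ofReal_le_ofReal (Real.exp_le_exp.2 (neg_le_neg ?_)))
    calc _ ≤ (C₁ + C₂ + 3) * (max 1 cg * (s₀ * Real.log m.G)) :=
          mul_le_mul_of_nonneg_left hR3 (by linarith)
      _ = (C₁ + C₂ + 3) * max 1 cg * (s₀ * Real.log m.G) := by ring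
      _ ≤ u / 2 * K * (s₀ * Real.log m.G) := mul_le_mul_of_nonneg_right hK (by linarith)
      _ = _ := by push_cast; ring
  have hM0 : 0 ≤ M := le_trans (by positivity) hM₂
  have hQ : M * T * m.rate s₀ ^ 2 = M * R := by rw [hRdef]; ring
  rw [hQ]
  have hQT : M * R ≤ T * vlo := by
    calc M * R = T * (M * m.rate s₀ ^ 2) := by rw [hRdef]; ring
      _ ≤ _ := mul_le_mul_of_nonneg_left hrateM hT0.le
  have hQx : 16 * (vhi * (4 * ((K + 1) * (1 + cg) + 1) * R)) ≤ M * R := by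
    calc _ = 16 * vhi * (4 * ((K + 1) * (1 + cg) + 1)) * R := by ring
      _ ≤ _ := mul_le_mul_of_nonneg_right hM₁ hR0.le
  have hmain := lintegral_posterior_predError_le (k₁ := s₀) (k₂ := K * s₀) (k := s₀ + K * s₀)
    (Q := M * R) (x := 4 * ((K + 1) * (1 + cg) + 1) * R) (γ := cg * Real.log m.G / Real.log T)
    (prior_univ_le_one hg hl ha hb hc hd) hT hG hvlo hv₀.1 hv₀.2 hθ₀s le_rfl (by positivity)
    hQT hQx (fun j ↦ (hgroup j).2) (Real.exp_pos _) hev hP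
  -- The spans cost `(K + 1) s₀ log G` in number and `cg` times that in dimension; the `+ 1` in the
  -- projection level leaves `R ≥ log T`.
  have e1 : (m.G : ℝ) ^ (s₀ + K * s₀) *
      Real.exp (((s₀ + K * s₀ : ℕ) : ℝ) * (cg * Real.log m.G / Real.log T) -
      4 * ((K + 1) * (1 + cg) + 1) * R / 4) ≤ Real.exp (-Real.log T) := by
    have hpow : (m.G : ℝ) ^ (s₀ + K * s₀) =
        Real.exp ((s₀ + K * s₀ : ℕ) * Real.log m.G) := by rw [Real.exp_nat_mul, hexpLG]
    rw [hpow, ← Real.exp_add]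
    refine Real.exp_le_exp.2 ?_
    push_cast
    have h1 : cg * Real.log m.G / Real.log T ≤ cg * Real.log m.G := div_le_self (by positivity) hLT
    have h2 : (s₀ + K * s₀ : ℝ) * (cg * Real.log m.G / Real.log T) ≤
        (s₀ + K * s₀ : ℝ) * (cg * Real.log m.G) := by gcongr
    have h3 : (K + 1) * (1 + cg) * (s₀ * Real.log m.G) ≤ (K + 1) * (1 + cg) * R := by gcongr
    linarith
  have e2 : Real.exp (-(M * R / (16 * vhi))) / Real.exp (-((C₁ + C₂ + 2) * R)) ≤
      Real.exp (-Real.log T) := by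
    rw [← Real.exp_sub]
    refine Real.exp_le_exp.2 ?_
    have : (C₁ + C₂ + 3) * R ≤ M * R / (16 * vhi) := by
      rw [le_div_iff₀ (by positivity)]
      calc _ = 16 * vhi * (C₁ + C₂ + 3) * R := by ring
        _ ≤ _ := mul_le_mul_of_nonneg_right hM₂ hR0.le
    linarith
  have e3 : Real.exp (-((C₁ + C₂ + 3) * R)) / Real.exp (-((C₁ + C₂ + 2) * R)) ≤
      Real.exp (-Real.log T) := by
    rw [← Real.exp_sub]
    refine Real.exp_le_exp.2 ?_
    linarith
  refine hmain.trans ?_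
  calc _ ≤ ENNReal.ofReal (2 * Real.exp (-(T / 12))) + ENNReal.ofReal (Real.exp (-Real.log T)) +
        ENNReal.ofReal (Real.exp (-Real.log T)) + ENNReal.ofReal (Real.exp (-Real.log T)) := by
        gcongr
    _ = _ := by
      rw [← ENNReal.ofReal_add (by positivity) (by positivity),
        ← ENNReal.ofReal_add (by positivity) (by positivity),
        ← ENNReal.ofReal_add (by positivity) (by positivity)]
      congr 1
      ring

end Model

end BMIDAS

/-! ### Choice of constants and passage to the limit. -/

theorem theorem1
    (vlo vhi cg cθ clo Chi cπ u dlo a₁ : ℝ)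
    (hvlo : 0 < vlo) (hv : vlo ≤ vhi) (hcg : 0 < cg) (hcθ : 0 < cθ)
    (hclo : 1 < clo) (hChi : clo < Chi) (hcπ : 0 < cπ) (hu : 0 < u) (hdlo : 0 < dlo)
    (ha₁ : 1 < a₁) :
    ∃ M₀ : ℝ, 0 < M₀ ∧
      ∀ (b₁ : ℝ) (m : (T : ℕ) → BMIDAS.Model T) (s₀ : ℕ → ℕ),
        0 < b₁ →
        (∀ᶠ T in atTop, s₀ T ≤ (m T).G) →
        (∀ᶠ T in atTop, (m T).GroupSize cg) →
        (∀ᶠ T in atTop, (m T).Penalty clo Chi) →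
        (∀ᶠ T in atTop, (m T).BetaHyper (s₀ T) u cπ dlo) →
        Tendsto (fun T => (m T).rate (s₀ T)) atTop (𝓝 0) →
        ∀ M : ℝ, M₀ ≤ M →
          Tendsto
            (fun T =>
              ⨆ θ₀ ∈ (m T).trueSlopes cθ (s₀ T), ⨆ v₀ ∈ Set.Icc vlo vhi,
                ∫⁻ y, (m T).posterior a₁ b₁ y
                    {q | M * T * (m T).rate (s₀ T) ^ 2 ≤ (m T).predError q.1 θ₀}
                  ∂((m T).dataLaw θ₀ v₀))
            atTop (𝓝 0) := by
  obtain ⟨C₁, hC₁⟩ : ∃ C₁, C₁ = 3 - Real.log (min dlo 1) + cπ := ⟨_, rfl⟩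
  obtain ⟨C₂, hC₂⟩ : ∃ C₂, C₂ = 5 * cg + Chi * (cθ * √cg + 1) / √(vlo / 2) := ⟨_, rfl⟩
  -- Above `K s₀` nonzero groups the prior tail beats the evidence cost.
  obtain ⟨K, hK⟩ := exists_nat_ge ((C₁ + C₂ + 3) * max 1 cg / (u / 2))
  rw [div_le_iff₀' (by positivity)] at hK
  have hvhi : 0 < vhi := by linarith
  -- The first bound makes the prediction error dominate the projected noise; the second makes the
  -- likelihood loss dominate the evidence cost.
  refine ⟨max (16 * vhi * (4 * ((K + 1) * (1 + cg) + 1))) (16 * vhi * (C₁ + C₂ + 3)),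
    lt_max_of_lt_left (by positivity), ?_⟩
  intro b m s₀ hb hs₀ hgroup hpen hbeta hrate M hM
  have hlog : Tendsto (fun T : ℕ ↦ Real.log T) atTop atTop :=
    Real.tendsto_log_atTop.comp tendsto_natCast_atTop_atTop
  have hcast : Tendsto (fun T : ℕ ↦ (T : ℝ)) atTop atTop := tendsto_natCast_atTop_atTop
  have hexplog : Tendsto (fun T : ℕ ↦ Real.exp (-Real.log T)) atTop (𝓝 0) :=
    Real.tendsto_exp_neg_atTop_nhds_zero.comp hlog
  have hbound : Tendsto (fun T : ℕ ↦ ENNReal.ofReal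
      (2 * Real.exp (-((T : ℝ) / 12)) + 3 * Real.exp (-Real.log T))) atTop (𝓝 0) := by
    have h1 : Tendsto (fun T : ℕ ↦ Real.exp (-((T : ℝ) / 12))) atTop (𝓝 0) :=
      Real.tendsto_exp_neg_atTop_nhds_zero.comp (hcast.atTop_div_const (by norm_num))
    have h2 := (h1.const_mul 2).add (hexplog.const_mul 3)
    simpa using ENNReal.tendsto_ofReal h2
  refine tendsto_of_tendsto_of_tendsto_of_le_of_le' tendsto_const_nhds hbound
    (Eventually.of_forall fun _ ↦ zero_le) ?_
  -- `H` is a threshold for `log G`, reached once `log T ≥ cg H`.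
  obtain ⟨H, hH, hHu, hHd⟩ : ∃ H : ℝ, 1 ≤ H ∧ Real.log 2 ≤ u / 2 * H ∧
      2 ≤ dlo * Real.exp (u * H) := by
    have hx : Tendsto (fun H : ℝ ↦ dlo * Real.exp (u * H)) atTop atTop :=
      (Real.tendsto_exp_atTop.comp (tendsto_id.const_mul_atTop hu)).const_mul_atTop hdlo
    have hy : Tendsto (fun H : ℝ ↦ u / 2 * H) atTop atTop :=
      tendsto_id.const_mul_atTop (by positivity)
    exact ((eventually_ge_atTop 1).and ((hy.eventually_ge_atTop _).and
      (hx.eventually_ge_atTop 2))).exists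
  -- The scale `b₁` affects only this constant, hence how large `T` must be but not `M₀`.
  have hconst0 : 0 < Real.exp (-(1 + 2 / vlo)) * (b ^ a₁ / Real.Gamma a₁ *
      (4 * vhi) ^ (-a₁ - 1) * Real.exp (-b / (vlo / 2)) * (vlo / 2)) := by
    have := Real.Gamma_pos_of_pos (by linarith : 0 < a₁)
    positivity
  have hrateM : ∀ᶠ T in atTop, M * (m T).rate (s₀ T) ^ 2 ≤ vlo := by
    have h := (hrate.pow 2).const_mul M
    simp only [ne_eq, OfNat.ofNat_ne_zero, not_false_eq_true, zero_pow, mul_zero] at h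
    exact (h.eventually_lt_const hvlo).mono fun _ h ↦ h.le
  filter_upwards [hs₀, hgroup, hpen, hbeta, eventually_ge_atTop 1,
    hcast.eventually_ge_atTop cg, hcast.eventually_ge_atTop (2 * √vhi),
    hlog.eventually_ge_atTop 1, hlog.eventually_ge_atTop (cg * H),
    hrate.eventually_lt_const one_pos, hrateM, hexplog.eventually_lt_const hconst0]
    with T h1 h2 h3 h4 h5 h6 h7 h8 h9 h10 h11 h12
  exact iSup₂_le fun θ₀ hθ₀ ↦ iSup₂_le fun v₀ hv₀ ↦
    BMIDAS.Model.lintegral_posterior_le_of_conditions hvlo hv hcg hcθ hclo hChi hcπ hu hdlo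
      (by linarith) hb hC₁ hC₂ hK ((le_max_left _ _).trans hM) ((le_max_right _ _).trans hM)
      hH hHu hHd h1 h2 h3 h4 h5 h6 h7 h8 h9 h10.le h11 h12.le hθ₀ hv₀
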